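/- **Setting.** Let $(X,d)$ be a complete metric space whose closed balls $\bar B(x,3)$ are compact. Suppose that for every $x\in X$ and $\varepsilon>0$ a homeomorphism $\delta^x_\varepsilon$ between open neighbourhoods of $x$ is given: $\delta^x_\varepsilon:U(x)\to V_\varepsilon(x)$ if $\varepsilon\le 1$, and $\delta^x_\varepsilon:W_\varepsilon(x)\to U(x)$ if $\varepsilon>1$. Consider the following axioms. * **A0.** There are $1<A<B$ such that for all $x\in X$ one has $\bar B(x,A)\subset U(x)$ and, for all $\varepsilon\in(0,1)$, $$B(x,\varepsilon)\subset\delta^x_\varepsilon B(x,A)\subset V_\varepsilon(x)\subset W_{\varepsilon^{-1}}(x)\subset\delta^x_\varepsilon\big(B(x,B)\cap U(x)\big).$$ Moreover for every compact $K\subset X$ there are $R>0$ and $\varepsilon_0\in(0,1)$ such that for all $x\in K$, $u,v\in\bar B(x,R)$, $\varepsilon\in(0,\varepsilon_0)$: $u,v\in U(x)$ and $\delta^x_\varepsilon v\in W_{\varepsilon^{-1}}(\delta^x_\varepsilon u)$. * **A1.** $\delta^x_\varepsilon x=x$ for all $\varepsilon>0$, and $\delta^x_1=\mathrm{id}$ on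 $U(x)$; the map $(\varepsilon,x,y)\mapsto\delta^x_\varepsilon y$ is continuous on its domain $\mathrm{dom}\,\delta\subset(0,\infty)\times X\times X$ and extends continuously to the closure of $\mathrm{dom}\,\delta$ in $[0,\infty)\times X\times X$; and $\lim_{\varepsilon\to0}\delta^x_\varepsilon y=x$ for $y\in U(x)$. * **A2.** For $x\in X$, $\varepsilon,\mu>0$ and $u\in U(x)$ for which $\delta^x_\mu u$ is defined, $\delta^x_\varepsilon\delta^x_\mu u$ is defined if and only if $\delta^x_{\varepsilon\mu}u$ is, and then they are equal. * **A3.** For every $x$ there is a distance $d^x$ on $\bar B(x,A)$ such that $\frac1\varepsilon d(\delta^x_\varepsilon u,\delta^x_\varepsilon v)\to d^x(u,v)$ as $\varepsilon\to0$, uniformly for $u,v\in\bar B(x,A)$ and for $x$ in compact sets. * **A4.** $\Delta^x_\varepsilon(u,v)=\delta^{\delta^x_\varepsilon u}_{\varepsilon^{-1}}\delta^x_\varepsilon v$ converges as $\varepsilon\to0$ to some $\Delta^x(u,v)$, uniformly for $x$ in compact sets and $u,v$ sufficiently close to $x$ (that is, for every compact $K$ there is $R>0$ such that, for small $\varepsilon$,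 $\Delta^x_\varepsilon(u,v)$ is defined for all $x\in K$, $u,v\in\bar B(x,R)$, and the convergence is uniform there). * **A4+.** A4 holds and, in the same sense, $\Sigma^x_\varepsilon(u,v)=\delta^x_{\varepsilon^{-1}}\delta^{\delta^x_\varepsilon u}_\varepsilon v$ converges to some $\Sigma^x(u,v)$. $(X,d,\delta)$ is a *strong dilatation structure* if A0–A4 hold (with the same $A$ in A0 and A3). It is *tempered* if $d$ is a length distance ($d(x,y)$ is the infimum of the lengths $l_d(c)$, i.e. the variations, of the Lipschitz curves $c$ from $x$ to $y$) and there are constants $0<c<C$ such that for every nonempty compact $K$ there is $\rho>0$ with $$c\,d^x(u,v)\le\tfrac1\varepsilon d(\delta^x_\varepsilon u,\delta^x_\varepsilon v)\le C\,d^x(u,v)$$ for all $x,u,v\in K$ at mutual distances at most $\rho$ and all $\varepsilon>0$ for which $\delta^x_\varepsilon u$ and $\delta^x_\varepsilon v$ are defined. It has the *Radon–Nikodym property* if every Lipschitz curve $c:[a,b]\to X$ is derivable at almost every $t$: there are $r>0$ and $f:(-r,r)\to U(c(t))$ that is a morphism of (local) conical groups, i.e. $f(\varepsilon s)=\delta^{c(t)}_\varepsilon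 f(s)$ for $\varepsilon>0$ and $s,\varepsilon s\in(-r,r)$, and $f(s+s')=\Sigma^{c(t)}(f(s),f(s'))$ for $s,s',s+s'\in(-r,r)$, such that $\frac1\varepsilon d\big(c(t+\varepsilon s),\delta^{c(t)}_\varepsilon f(s)\big)\to0$ as $\varepsilon\to0^+$, uniformly in $s\in(-r,r)$. For $\varepsilon\in(0,1)$ let $\mathcal L_\varepsilon$ be the set of pairs $(x,c)$ with $x\in X$ and $c:[0,1]\to U(x)$ continuous such that $\delta^x_\varepsilon c$ is $d$-Lipschitz with $\mathrm{Lip}(\delta^x_\varepsilon c)\le 2\,l_d(\delta^x_\varepsilon c)$, and put $l_\varepsilon(x,c)=\frac1\varepsilon l_d(\delta^x_\varepsilon c)$ on $\mathcal L_\varepsilon$. Give pairs the distance $D((x,c),(x',c'))=\max\{d(x,x'),\sup_t d(c(t),c'(t))\}$. Let $\mathcal L$ be the set of pairs $(x,c)$ with $x\in X$ and $c:[0,1]\to U(x)$ continuous that are limits of pairs $(x_n,c_n)\in\mathcal L_{\varepsilon_n}$ with $(c_n)$ equicontinuous, for some sequence $\varepsilon_n\to0$ in $(0,1)$. * **A3L.**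 There is a functional $l:\mathcal L\to[0,\infty]$ such that for every sequence $\varepsilon_n\to0$ in $(0,1)$ the functionals $l_{\varepsilon_n}$ Gamma-converge to $l$, i.e. (a) $l(z)\le\liminf_n l_{\varepsilon_n}(z_n)$ whenever $z_n\in\mathcal L_{\varepsilon_n}$ and $z_n\to z\in\mathcal L$; (b) for every $z\in\mathcal L$ there are $z_n\in\mathcal L_{\varepsilon_n}$ with $z_n\to z$ and $l_{\varepsilon_n}(z_n)\to l(z)$. $(X,d,\delta)$ is a *length dilatation structure* if $(X,d)$ is complete and locally compact and A0, A1, A2, A3L and A4+ hold. **Corollary.** Every tempered strong dilatation structure with the Radon–Nikodym property is a length dilatation structure. -/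

import Mathlib

open Set Filter Topology Metric MeasureTheory
open scoped NNReal ENNReal unitInterval

/-- The data of a field of dilatations on a metric space `X`: for every `x` and every `ε > 0` a
homeomorphism between open neighbourhoods of `x`, namely `δ ε x : U x → V ε x` if `ε ≤ 1` and
`δ ε x : W ε x → U x` if `ε > 1`. The values of `δ ε x` off its domain are irrelevant, and
so are `V ε x` for `ε > 1` and `W ε x` for `ε ≤ 1`. -/
structure DilationField (X : Type*) [MetricSpace X] where
  U : X → Set X
  V : ℝ → X → Set X
  W : ℝ → X → Set X
  δ : ℝ → X → X → X
  isOpen_U : ∀ x, IsOpen (U x)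
  mem_U : ∀ x, x ∈ U x
  isOpen_V : ∀ ε x, 0 < ε → ε ≤ 1 → IsOpen (V ε x)
  mem_V : ∀ ε x, 0 < ε → ε ≤ 1 → x ∈ V ε x
  isOpen_W : ∀ ε x, 1 < ε → IsOpen (W ε x)
  mem_W : ∀ ε x, 1 < ε → x ∈ W ε x
  /-- for `ε ≤ 1`, `δ ε x` is a homeomorphism of `U x` onto `V ε x` -/
  embedding_of_le : ∀ ε x, 0 < ε → ε ≤ 1 → IsEmbedding ((U x).domRestrict (δ ε x))
  image_of_le : ∀ ε x, 0 < ε → ε ≤ 1 → δ ε x '' U x = V ε x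
  /-- for `ε > 1`, `δ ε x` is a homeomorphism of `W ε x` onto `U x` -/
  embedding_of_gt : ∀ ε x, 1 < ε → IsEmbedding ((W ε x).domRestrict (δ ε x))
  image_of_gt : ∀ ε x, 1 < ε → δ ε x '' W ε x = U x

namespace DilationField

variable {X : Type*} [MetricSpace X]

/-- The domain of definition of `δ ε x`, for `ε > 0`. -/
def dom (D : DilationField X) (ε : ℝ) (x : X) : Set X :=
  {y | (ε ≤ 1 → y ∈ D.U x) ∧ (1 < ε → y ∈ D.W ε x)}

/-- The set `dom δ` of all `(ε, x, y)` with `ε > 0` for which `δ ε x y` is defined. -/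
def totalDom (D : DilationField X) : Set (ℝ × X × X) :=
  {p | 0 < p.1 ∧ p.2.2 ∈ D.dom p.1 p.2.1}

/-- The approximate difference `Δ^x_ε(u, v) = δ^{δ^x_ε u}_{1/ε} δ^x_ε v`. -/
noncomputable def Delta (D : DilationField X) (ε : ℝ) (x u v : X) : X :=
  D.δ ε⁻¹ (D.δ ε x u) (D.δ ε x v)

/-- `Δ^x_ε(u, v)` is well defined (`0 < ε < 1`). -/
def DeltaDefined (D : DilationField X) (ε : ℝ) (x u v : X) : Prop :=
  u ∈ D.U x ∧ v ∈ D.U x ∧ D.δ ε x v ∈ D.W ε⁻¹ (D.δ ε x u)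

/-- The approximate sum `Σ^x_ε(u, v) = δ^x_{1/ε} δ^{δ^x_ε u}_ε v`. -/
noncomputable def Sigma (D : DilationField X) (ε : ℝ) (x u v : X) : X :=
  D.δ ε⁻¹ x (D.δ ε (D.δ ε x u) v)

/-- `Σ^x_ε(u, v)` is well defined (`0 < ε < 1`). -/
def SigmaDefined (D : DilationField X) (ε : ℝ) (x u v : X) : Prop :=
  u ∈ D.U x ∧ v ∈ D.U (D.δ ε x u) ∧ D.δ ε (D.δ ε x u) v ∈ D.W ε⁻¹ x

/-- Axiom A0, with the constants `A` and `B`. -/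
structure AxiomA0 (D : DilationField X) (A B : ℝ) : Prop where
  one_lt : 1 < A
  lt : A < B
  closedBall_subset : ∀ x, closedBall x A ⊆ D.U x
  ball_subset : ∀ x, ∀ ε ∈ Ioo (0 : ℝ) 1, ball x ε ⊆ D.δ ε x '' ball x A
  image_subset : ∀ x, ∀ ε ∈ Ioo (0 : ℝ) 1, D.δ ε x '' ball x A ⊆ D.V ε x
  V_subset : ∀ x, ∀ ε ∈ Ioo (0 : ℝ) 1, D.V ε x ⊆ D.W ε⁻¹ x
  /-- the image under `δ ε x` of the ball of radius `B` is that of the part of the ball on which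
  `δ ε x` is defined -/
  W_subset : ∀ x, ∀ ε ∈ Ioo (0 : ℝ) 1, D.W ε⁻¹ x ⊆ D.δ ε x '' (ball x B ∩ D.U x)
  defined : ∀ K : Set X, IsCompact K → ∃ R > 0, ∃ ε₀ ∈ Ioo (0 : ℝ) 1,
    ∀ x ∈ K, ∀ u ∈ closedBall x R, ∀ v ∈ closedBall x R, ∀ ε ∈ Ioo 0 ε₀,
      D.DeltaDefined ε x u v

/-- Axiom A1. -/
structure AxiomA1 (D : DilationField X) : Prop where
  fix : ∀ ε x, 0 < ε → D.δ ε x x = x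
  one : ∀ x, ∀ u ∈ D.U x, D.δ 1 x u = u
  continuousOn : ContinuousOn (fun p : ℝ × X × X => D.δ p.1 p.2.1 p.2.2) D.totalDom
  extension : ∃ F : ℝ × X × X → X, ContinuousOn F (closure D.totalDom) ∧
    ∀ p ∈ D.totalDom, F p = D.δ p.1 p.2.1 p.2.2
  tendsto : ∀ x, ∀ y ∈ D.U x, Tendsto (fun ε => D.δ ε x y) (𝓝[>] 0) (𝓝 x)

/-- Axiom A2: once `δ^x_μ u` makes sense, `δ^x_ε δ^x_μ u` is defined if and only if `δ^x_{εμ} u`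
is, and then the two are equal. -/
def AxiomA2 (D : DilationField X) : Prop :=
  ∀ x, ∀ ε > 0, ∀ μ > 0, ∀ u ∈ D.U x, u ∈ D.dom μ x →
    (D.δ μ x u ∈ D.dom ε x ↔ u ∈ D.dom (ε * μ) x) ∧
    (D.δ μ x u ∈ D.dom ε x → D.δ ε x (D.δ μ x u) = D.δ (ε * μ) x u)

/-- Axiom A3: `d x` is a distance on the closed ball of radius `A` around `x`, and it is the limit
of the rescaled distances, uniformly on this ball and uniformly for `x` in compact sets. -/
structure AxiomA3 (D : DilationField X) (A : ℝ) (d : X → X → X → ℝ) : Prop where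
  nonneg : ∀ x, ∀ u ∈ closedBall x A, ∀ v ∈ closedBall x A, 0 ≤ d x u v
  eq_zero_iff : ∀ x, ∀ u ∈ closedBall x A, ∀ v ∈ closedBall x A, d x u v = 0 ↔ u = v
  symm : ∀ x, ∀ u ∈ closedBall x A, ∀ v ∈ closedBall x A, d x u v = d x v u
  triangle : ∀ x, ∀ u ∈ closedBall x A, ∀ v ∈ closedBall x A, ∀ w ∈ closedBall x A,
    d x u w ≤ d x u v + d x v w
  tendsto : ∀ K : Set X, IsCompact K → ∀ η > 0, ∃ ε₀ > 0, ∀ ε ∈ Ioo 0 ε₀, ∀ x ∈ K,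
    ∀ u ∈ closedBall x A, ∀ v ∈ closedBall x A,
      |1 / ε * dist (D.δ ε x u) (D.δ ε x v) - d x u v| ≤ η

/-- The operations `F ε x u v`, defined where `P ε x u v` holds, converge to `G x u v` as `ε → 0`,
uniformly for `x` in a compact set and `u, v` sufficiently close to `x`. -/
def ConvergesNear (P : ℝ → X → X → X → Prop) (F : ℝ → X → X → X → X) (G : X → X → X → X) :
    Prop :=
  ∀ K : Set X, IsCompact K → ∃ R > 0,
    (∃ ε₀ ∈ Ioo (0 : ℝ) 1, ∀ ε ∈ Ioo 0 ε₀, ∀ x ∈ K, ∀ u ∈ closedBall x R, ∀ v ∈ closedBall x R,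
      P ε x u v) ∧
    TendstoUniformlyOn (fun ε (p : X × X × X) => F ε p.1 p.2.1 p.2.2)
      (fun p => G p.1 p.2.1 p.2.2) (𝓝[>] 0)
      {p | p.1 ∈ K ∧ p.2.1 ∈ closedBall p.1 R ∧ p.2.2 ∈ closedBall p.1 R}

/-- Axiom A4. -/
def AxiomA4 (D : DilationField X) : Prop :=
  ∃ G : X → X → X → X, ConvergesNear D.DeltaDefined D.Delta G

/-- Axiom A4+. -/
def AxiomA4Plus (D : DilationField X) : Prop :=
  (∃ G : X → X → X → X, ConvergesNear D.DeltaDefined D.Delta G) ∧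
  (∃ S : X → X → X → X, ConvergesNear D.SigmaDefined D.Sigma S)

/-- `(X, dist, D)` is a strong dilatation structure, with the constants `A`, `B` of A0 and the
tangent distances `d x` of A3. -/
structure IsStrongDilatationStructure (D : DilationField X) (A B : ℝ) (d : X → X → X → ℝ) :
    Prop where
  complete : CompleteSpace X
  compact_closedBall : ∀ x : X, IsCompact (closedBall x 3)
  a0 : D.AxiomA0 A B
  a1 : D.AxiomA1
  a2 : D.AxiomA2
  a3 : D.AxiomA3 A d
  a4 : D.AxiomA4

end DilationField

/-- `X` is a length metric space: the distance of two points is the infimum of the lengths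
(variations) of the Lipschitz curves that join them. The infimum of the empty set is `∞`, so that
any two points are joined by a Lipschitz curve. -/
def IsLengthMetric (X : Type*) [MetricSpace X] : Prop :=
  ∀ x y : X, edist x y = sInf {L : ℝ≥0∞ | ∃ (a b : ℝ) (c : ℝ → X) (k : ℝ≥0), a ≤ b ∧
    LipschitzOnWith k c (Icc a b) ∧ c a = x ∧ c b = y ∧ L = eVariationOn c (Icc a b)}

namespace DilationField

variable {X : Type*} [MetricSpace X]

/-- The dilatation structure is tempered: the distance is a length distance, and for `x, u, v`
sufficiently close the rescaled distances are uniformly comparable with the tangent distance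
`d x`, for all `ε > 0` for which they are defined. -/
def IsTempered (D : DilationField X) (d : X → X → X → ℝ) : Prop :=
  IsLengthMetric X ∧ ∃ c C : ℝ, 0 < c ∧ c < C ∧
    ∀ K : Set X, IsCompact K → K.Nonempty → ∃ ρ > 0, ∀ x ∈ K, ∀ u ∈ K, ∀ v ∈ K,
      dist x u ≤ ρ → dist x v ≤ ρ → dist u v ≤ ρ →
      ∀ ε > 0, u ∈ D.dom ε x → v ∈ D.dom ε x →
        c * d x u v ≤ 1 / ε * dist (D.δ ε x u) (D.δ ε x v) ∧
        1 / ε * dist (D.δ ε x u) (D.δ ε x v) ≤ C * d x u v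

/-- `f`, on the interval `(-r, r)`, is a morphism from the conical group `ℝ` (addition, with
multiplication by `ε > 0` as dilatations) to the tangent conical group at `x`, whose operation is
the limit `Σ^x` of the operations `Σ^x_ε` and whose dilatations are the `δ^x_ε`. -/
structure IsConicalMorphism (D : DilationField X) (x : X) (r : ℝ) (f : ℝ → X) : Prop where
  mem : ∀ s ∈ Ioo (-r) r, f s ∈ D.U x
  dilation : ∀ s ∈ Ioo (-r) r, ∀ ε > 0, ε * s ∈ Ioo (-r) r →
    f s ∈ D.dom ε x ∧ f (ε * s) = D.δ ε x (f s)
  defined : ∀ s ∈ Ioo (-r) r, ∀ t ∈ Ioo (-r) r, s + t ∈ Ioo (-r) r →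
    ∀ᶠ ε in 𝓝[>] (0 : ℝ), D.SigmaDefined ε x (f s) (f t)
  add : ∀ s ∈ Ioo (-r) r, ∀ t ∈ Ioo (-r) r, s + t ∈ Ioo (-r) r →
    Tendsto (fun ε => D.Sigma ε x (f s) (f t)) (𝓝[>] 0) (𝓝 (f (s + t)))

/-- The curve `c` is derivable at the parameter `t` with respect to the dilatations: there is a
conical group morphism `f` from a neighbourhood of `0` in `ℝ` to the tangent space at `c t` with
`dist (c (t + ε s)) (δ^{c t}_ε (f s)) = o(ε)` uniformly in `s`. -/
def DerivableAt (D : DilationField X) (c : ℝ → X) (t : ℝ) : Prop :=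
  ∃ r > 0, ∃ f : ℝ → X, D.IsConicalMorphism (c t) r f ∧
    ∀ η > 0, ∀ᶠ ε in 𝓝[>] (0 : ℝ), ∀ s ∈ Ioo (-r) r,
      1 / ε * dist (c (t + ε * s)) (D.δ ε (c t) (f s)) ≤ η

/-- The Radon-Nikodym property: every Lipschitz curve is derivable almost everywhere. -/
def HasRadonNikodym (D : DilationField X) : Prop :=
  ∀ (a b : ℝ) (c : ℝ → X) (k : ℝ≥0), a < b → LipschitzOnWith k c (Icc a b) →
    ∀ᵐ t ∂(volume : Measure ℝ), t ∈ Ioo a b → D.DerivableAt c t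

/-- The length (variation) of a curve parameterized by `[0, 1]`. -/
noncomputable def curveLength (γ : I → X) : ℝ≥0∞ := eVariationOn γ univ

/-- The rescaled length functional `l_ε(x, c) = (1 / ε) l(δ^x_ε c)`. -/
noncomputable def rescaledLength (D : DilationField X) (ε : ℝ) (z : X × C(I, X)) : ℝ≥0∞ :=
  (ENNReal.ofReal ε)⁻¹ * curveLength (fun t => D.δ ε z.1 (z.2 t))

/-- The domain of `l_ε`: the pairs `(x, c)` with `c` in `U x` such that `δ^x_ε c` is Lipschitz
with `Lip (δ^x_ε c) ≤ 2 l(δ^x_ε c)`. -/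
def curveDomain (D : DilationField X) (ε : ℝ) : Set (X × C(I, X)) :=
  {z | (∀ t, z.2 t ∈ D.U z.1) ∧
    ∃ k : ℝ≥0, LipschitzWith k (fun t => D.δ ε z.1 (z.2 t)) ∧
      (k : ℝ≥0∞) ≤ 2 * curveLength (fun t => D.δ ε z.1 (z.2 t))}

/-- The domain of the limit functional: the pairs `(x, c)` with `c` in `U x` that are limits of
pairs `(x_n, c_n)` in the domain of `l_{ε_n}` with `(c_n)` equicontinuous, for some `ε_n → 0`. -/
def limitDomain (D : DilationField X) : Set (X × C(I, X)) :=
  {z | (∀ t, z.2 t ∈ D.U z.1) ∧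
    ∃ (ε : ℕ → ℝ) (w : ℕ → X × C(I, X)), (∀ n, ε n ∈ Ioo (0 : ℝ) 1) ∧
      Tendsto ε atTop (𝓝 0) ∧ (∀ n, w n ∈ D.curveDomain (ε n)) ∧
      Equicontinuous (fun n (t : I) => (w n).2 t) ∧ Tendsto w atTop (𝓝 z)}

end DilationField

/-- The functionals `F n`, with domains `S n`, Gamma-converge to the functional `F₀`, with
domain `S₀`. -/
structure GammaConverges {Z : Type*} [MetricSpace Z] (S : ℕ → Set Z) (F : ℕ → Z → ℝ≥0∞)
    (S₀ : Set Z) (F₀ : Z → ℝ≥0∞) : Prop where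
  liminf_le : ∀ z₀ ∈ S₀, ∀ z : ℕ → Z, (∀ n, z n ∈ S n) → Tendsto z atTop (𝓝 z₀) →
    F₀ z₀ ≤ liminf (fun n => F n (z n)) atTop
  recovery : ∀ z₀ ∈ S₀, ∃ z : ℕ → Z, (∀ n, z n ∈ S n) ∧ Tendsto z atTop (𝓝 z₀) ∧
    Tendsto (fun n => F n (z n)) atTop (𝓝 (F₀ z₀))

namespace DilationField

variable {X : Type*} [MetricSpace X]

/-- Axiom A3L: there is one functional `l` to which the rescaled length functionals `l_{ε_n}`
Gamma-converge, whatever the sequence `ε_n → 0`. -/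
def AxiomA3L (D : DilationField X) : Prop :=
  ∃ l : X × C(I, X) → ℝ≥0∞, ∀ ε : ℕ → ℝ, (∀ n, ε n ∈ Ioo (0 : ℝ) 1) → Tendsto ε atTop (𝓝 0) →
    GammaConverges (fun n => D.curveDomain (ε n)) (fun n => D.rescaledLength (ε n))
      D.limitDomain l

/-- `(X, dist, D)` is a length dilatation structure. -/
structure IsLengthDilatationStructure (D : DilationField X) : Prop where
  complete : CompleteSpace X
  locallyCompact : LocallyCompactSpace X
  a0 : ∃ A B : ℝ, D.AxiomA0 A B
  a1 : D.AxiomA1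
  a2 : D.AxiomA2
  a3L : D.AxiomA3L
  a4Plus : D.AxiomA4Plus

end DilationField

/-!
The proof has two independent parts.

**Gamma-convergence.** On all of `U x` the rescaled distances `(1 / ε) d(δ^x_ε u, δ^x_ε v)`
converge to a distance, jointly in `ε`, `x`, `u`, `v`: a fixed dilatation maps compact subsets of
`U x` into the ball where A3 applies, and A2 turns it into a change of scale
(`tendsto_rescaledDist`). The Gamma-limit at `(x, c)` is the maximum of the length of `c` for this
tangent distance and of half of the Lipschitz constant of `c` (`limitLength`). The second term is
forced by the condition `Lip ≤ 2 l` on the approximating curves: it passes to the limit as an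
inequality between the Lipschitz constant and the limit of the lengths, even where length is lost.

The lower bound (`limitLength_le_liminf`) is the convergence of the sums over partitions and of the
Lipschitz quotients. For the upper bound (`exists_near_mem_curveDomain`), `c` is replaced by a
polygonal curve: the points `δ^x_ε (c (i / N))` are joined by curves in the length space `X`, and
these are pulled back by `δ^x_ε`, which is possible uniformly on compact sets
(`exists_preimage_near`). The point is to control the speed as well as the length. In a nontrivial
length space two points at distance `< m` are joined by a curve of length exactly `m`, if `m` is
small (`IsLengthMetric.exists_hasUnitSpeedOn_of_dist_lt`), so that the lengths of the pieces can be
prescribed, in such a way that the total length is slightly above `limitLength` and no piece is run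
through at more than twice the average speed.

**Convergence of the approximate sums.** One has `Σ^x_ε(u, v) = Δ^{x'}_ε(Δ^x_ε(u, x), v)` with `x'
= δ^x_ε u` (`sigma_eq_delta`), so that the convergence of the approximate sums follows from A4,
from `x' → x`, and from the continuity of the limit of the `Δ_ε`.
-/

/-! ### Unit speed curves in length spaces -/

section LengthSpace

variable {X : Type*} [MetricSpace X]

theorem hasUnitSpeedOn_Icc_iff {γ : ℝ → X} {a b : ℝ} :
    HasUnitSpeedOn γ (Icc a b) ↔
      ∀ x y, a ≤ x → x ≤ y → y ≤ b → eVariationOn γ (Icc x y) = ENNReal.ofReal (y - x) := by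
  have key : ∀ x y, a ≤ x → y ≤ b → Icc a b ∩ Icc x y = Icc x y := fun x y hx hy =>
    inter_eq_right.2 (Icc_subset_Icc hx hy)
  rw [HasUnitSpeedOn, hasConstantSpeedOnWith_iff_ordered]
  simp only [NNReal.coe_one, one_mul]
  constructor
  · intro h x y hx hxy hy
    rw [← key x y hx hy]
    exact h ⟨hx, hxy.trans hy⟩ ⟨hx.trans hxy, hy⟩ hxy
  · rintro h x ⟨hx, -⟩ y ⟨-, hy⟩ hxy
    rw [key x y hx hy]
    exact h x y hx hxy hy

theorem HasUnitSpeedOn.lipschitzOnWith {γ : ℝ → X} {a b : ℝ} (h : HasUnitSpeedOn γ (Icc a b)) :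
    LipschitzOnWith 1 γ (Icc a b) := by
  have main : ∀ x ∈ Icc a b, ∀ y ∈ Icc a b, x ≤ y → edist (γ x) (γ y) ≤ edist x y := by
    intro x hx y hy hxy
    have h1 := eVariationOn.edist_le γ (left_mem_Icc.2 hxy) (right_mem_Icc.2 hxy)
    rw [hasUnitSpeedOn_Icc_iff.1 h x y hx.1 hxy hy.2] at h1
    rwa [edist_comm x, edist_dist y, Real.dist_eq, abs_of_nonneg (sub_nonneg.2 hxy)]
  intro x hx y hy
  rw [ENNReal.coe_one, one_mul]
  rcases le_total x y with hxy | hxy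
  · exact main x hx y hy hxy
  · rw [edist_comm, edist_comm x]
    exact main y hy x hx hxy

theorem HasUnitSpeedOn.comp_sub_const {γ : ℝ → X} {a b : ℝ} (h : HasUnitSpeedOn γ (Icc a b))
    (u : ℝ) : HasUnitSpeedOn (fun t => γ (t - u)) (Icc (a + u) (b + u)) := by
  rw [hasUnitSpeedOn_Icc_iff] at h ⊢
  intro x y hx hxy hy
  have := eVariationOn.comp_eq_of_monotoneOn γ (t := Icc x y) (fun t => t - u)
    (fun s _ t _ hst => sub_le_sub_right hst u)
  rw [image_sub_const_Icc, h _ _ (by linarith) (by linarith) (by linarith)] at this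
  rw [show y - x = y - u - (x - u) by ring, ← this]
  rfl

theorem HasUnitSpeedOn.comp_const_sub {γ : ℝ → X} {a b : ℝ} (h : HasUnitSpeedOn γ (Icc a b))
    (u : ℝ) : HasUnitSpeedOn (fun t => γ (u - t)) (Icc (u - b) (u - a)) := by
  rw [hasUnitSpeedOn_Icc_iff] at h ⊢
  intro x y hx hxy hy
  have := eVariationOn.comp_eq_of_antitoneOn γ (t := Icc x y) (fun t => u - t)
    (fun s _ t _ hst => sub_le_sub_left hst u)
  rw [image_const_sub_Icc, h _ _ (by linarith) (by linarith) (by linarith)] at this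
  rw [show y - x = u - x - (u - y) by ring, ← this]
  rfl

theorem HasUnitSpeedOn.congr {γ γ' : ℝ → X} {s : Set ℝ} (h : HasUnitSpeedOn γ s)
    (hγ : EqOn γ' γ s) : HasUnitSpeedOn γ' s := by
  intro x hx y hy
  rw [← h hx hy]
  exact eVariationOn.congr (hγ.mono inter_subset_left)

/-- Concatenation of two curves of unit speed. -/
theorem HasUnitSpeedOn.exists_concat {γ₁ γ₂ : ℝ → X} {l₁ l₂ : ℝ} (h₁ : HasUnitSpeedOn γ₁ (Icc 0 l₁))
    (h₂ : HasUnitSpeedOn γ₂ (Icc 0 l₂)) (hl₁ : 0 ≤ l₁) (hl₂ : 0 ≤ l₂) (h : γ₁ l₁ = γ₂ 0) :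
    ∃ γ : ℝ → X, γ 0 = γ₁ 0 ∧ γ (l₁ + l₂) = γ₂ l₂ ∧ HasUnitSpeedOn γ (Icc 0 (l₁ + l₂)) := by
  have hright : ∀ t, l₁ ≤ t → (if t ≤ l₁ then γ₁ t else γ₂ (t - l₁)) = γ₂ (t - l₁) := by
    intro t ht
    split_ifs with ht'
    · rw [le_antisymm ht' ht, sub_self, h]
    · rfl
  refine ⟨fun t => if t ≤ l₁ then γ₁ t else γ₂ (t - l₁), if_pos hl₁, ?_, ?_⟩
  · simpa using hright (l₁ + l₂) (by linarith)
  · refine HasUnitSpeedOn.Icc_Icc (y := l₁) (h₁.congr fun t ht => if_pos ht.2) ?_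
    have := h₂.comp_sub_const l₁
    rw [zero_add, add_comm] at this
    exact this.congr fun t ht => hright t ht.1

theorem LipschitzOnWith.exists_hasUnitSpeedOn {c : ℝ → X} {k : ℝ≥0} {a b : ℝ}
    (hc : LipschitzOnWith k c (Icc a b)) (hab : a ≤ b) :
    ∃ (l : ℝ) (γ : ℝ → X), 0 ≤ l ∧ γ 0 = c a ∧ γ l = c b ∧ HasUnitSpeedOn γ (Icc 0 l) ∧
      ENNReal.ofReal l = eVariationOn c (Icc a b) := by
  have hle : ∀ x y, a ≤ x → x ≤ y → y ≤ b →
      eVariationOn c (Icc x y) ≤ k * ENNReal.ofReal (y - x) := by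
    intro x y hx hxy hy
    refine ((hc.mono (Icc_subset_Icc hx hy)).comp_eVariationOn_le (g := id) (mapsTo_id _)).trans ?_
    gcongr
    have := (monotone_id (α := ℝ)).monotoneOn (Icc x y) |>.eVariationOn_eq
      (left_mem_Icc.2 hxy) (right_mem_Icc.2 hxy)
    rw [inter_self] at this
    exact this.le
  have hbv : LocallyBoundedVariationOn c (Icc a b) := by
    refine BoundedVariationOn.locallyBoundedVariationOn ?_
    exact ne_top_of_le_ne_top (by finiteness) (hle a b le_rfl hab le_rfl)
  have ha : a ∈ Icc a b := left_mem_Icc.2 hab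
  have hb : b ∈ Icc a b := right_mem_Icc.2 hab
  have hmono := variationOnFromTo.monotoneOn hbv ha
  have hlip : LipschitzOnWith k (variationOnFromTo c (Icc a b) a) (Icc a b) := by
    refine LipschitzOnWith.of_le_add_mul k fun x hx y hy => ?_
    rcases le_total x y with hxy | hxy
    · have := hmono hx hy hxy
      have : 0 ≤ k * dist x y := by positivity
      linarith
    · rw [← variationOnFromTo.add hbv ha hy hx, variationOnFromTo.eq_of_le _ _ hxy,
        inter_eq_right.2 (Icc_subset_Icc hy.1 hx.2), Real.dist_eq, abs_of_nonneg (by linarith)]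
      gcongr
      refine ENNReal.toReal_le_of_le_ofReal (by have := sub_nonneg.2 hxy; positivity) ?_
      rw [ENNReal.ofReal_mul k.coe_nonneg, ENNReal.ofReal_coe_nnreal]
      exact hle y x hy.1 hxy hx.2
  have himage : variationOnFromTo c (Icc a b) a '' Icc a b =
      Icc 0 (variationOnFromTo c (Icc a b) a b) := by
    refine Subset.antisymm ?_ ?_
    · rintro _ ⟨t, ht, rfl⟩
      exact ⟨variationOnFromTo.nonneg_of_le _ _ ht.1, hmono ht hb ht.2⟩
    · have := intermediate_value_Icc hab hlip.continuousOn
      rwa [variationOnFromTo.self] at this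
  have hunit := has_unit_speed_naturalParameterization c hbv ha
  rw [himage] at hunit
  refine ⟨_, _, variationOnFromTo.nonneg_of_le _ _ hab, ?_, ?_, hunit, ?_⟩
  · have := edist_naturalParameterization_eq_zero hbv ha ha
    rw [variationOnFromTo.self] at this
    exact edist_eq_zero.1 this
  · exact edist_eq_zero.1 (edist_naturalParameterization_eq_zero hbv ha hb)
  · rw [variationOnFromTo.eq_of_le _ _ hab, inter_self, ENNReal.ofReal_toReal]
    exact ne_top_of_le_ne_top (by finiteness) (hle a b le_rfl hab le_rfl)

theorem IsLengthMetric.exists_hasUnitSpeedOn (hX : IsLengthMetric X) {p q : X} {m : ℝ}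
    (hm : dist p q < m) :
    ∃ (l : ℝ) (γ : ℝ → X), 0 ≤ l ∧ l < m ∧ γ 0 = p ∧ γ l = q ∧ HasUnitSpeedOn γ (Icc 0 l) := by
  have hlt : edist p q < ENNReal.ofReal m := by
    rw [edist_dist]
    exact (ENNReal.ofReal_lt_ofReal_iff (dist_nonneg.trans_lt hm)).2 hm
  rw [hX p q, sInf_lt_iff] at hlt
  obtain ⟨_, ⟨a, b, c, k, hab, hc, rfl, rfl, rfl⟩, hlt⟩ := hlt
  obtain ⟨l, γ, hl, h0, h1, hγ, heq⟩ := hc.exists_hasUnitSpeedOn hab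
  rw [← heq] at hlt
  exact ⟨l, γ, hl, (ENNReal.ofReal_lt_ofReal_iff (dist_nonneg.trans_lt hm)).1 hlt, h0, h1, hγ⟩

/-- In a nontrivial length space, two points at distance `< m` are joined by a curve of length
exactly `m`, provided that `m` is small: a detour of the right length, back and forth along some
curve, is added to an almost shortest curve. -/
theorem IsLengthMetric.exists_hasUnitSpeedOn_of_dist_lt (hX : IsLengthMetric X) {a b p q : X}
    {m : ℝ} (hm : dist p q < m) (hmab : m ≤ dist a b) :
    ∃ γ : ℝ → X, γ 0 = p ∧ γ m = q ∧ HasUnitSpeedOn γ (Icc 0 m) := by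
  obtain ⟨l, γ, hl, hlm, rfl, rfl, hγ⟩ := hX.exists_hasUnitSpeedOn hm
  -- One of the two points `a`, `b` is far enough from the end point to make room for the detour.
  obtain ⟨q', hq'⟩ : ∃ q', m / 2 ≤ dist (γ l) q' := by
    by_contra! h
    have h1 := h a
    have h2 := h b
    have := dist_triangle_left a b (γ l)
    linarith
  obtain ⟨r, β, hr, -, hβ0, hβr, hβ⟩ := hX.exists_hasUnitSpeedOn (lt_add_one (dist (γ l) q'))
  have hmr : m / 2 ≤ r := by
    have h1 := hβ.lipschitzOnWith.dist_le_mul 0 ⟨le_rfl, hr⟩ r ⟨hr, le_rfl⟩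
    rw [hβ0, hβr, Real.dist_eq, zero_sub, abs_neg, abs_of_nonneg hr, NNReal.coe_one, one_mul] at h1
    linarith
  set s := (m - l) / 2 with hs
  have hs0 : 0 ≤ s := by linarith
  have hβ1 : HasUnitSpeedOn β (Icc 0 s) := by
    rw [hasUnitSpeedOn_Icc_iff] at hβ ⊢
    exact fun x y hx hxy hy => hβ x y hx hxy (by linarith)
  have hβ2 := hβ1.comp_const_sub s
  rw [sub_self, sub_zero] at hβ2
  obtain ⟨τ, hτ0, hτ1, hτ⟩ := hβ1.exists_concat hβ2 hs0 hs0 (by simp)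
  obtain ⟨γ', h0, h1, h⟩ := hγ.exists_concat hτ hl (by linarith) (by rw [hτ0, hβ0])
  have hlm : l + (s + s) = m := by linarith
  rw [hlm] at h1 h
  refine ⟨γ', h0, ?_, h⟩
  rw [h1, hτ1]
  simp [hβ0]

/-- In a nontrivial length space, two points at small distance `< m` are joined by a curve that is
parameterized on `[a, b]` with constant speed and has length exactly `m`. -/
theorem IsLengthMetric.exists_constant_speed (hX : IsLengthMetric X) {x₀ y₀ p q : X}
    {m a b : ℝ} (hm : dist p q < m) (hm' : m ≤ dist x₀ y₀) (hab : a < b) :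
    ∃ g : ℝ → X, g a = p ∧ g b = q ∧ eVariationOn g (Icc a b) = ENNReal.ofReal m ∧
      (∀ s ∈ Icc a b, ∀ t ∈ Icc a b, dist (g s) (g t) ≤ m / (b - a) * dist s t) ∧
      ∀ t ∈ Icc a b, dist (g t) p ≤ m := by
  obtain ⟨γ, h0, h1, hγ⟩ := hX.exists_hasUnitSpeedOn_of_dist_lt hm hm'
  have hm0 : 0 < m := dist_nonneg.trans_lt hm
  have hba : 0 < b - a := sub_pos.2 hab
  set φ : ℝ → ℝ := fun t => m / (b - a) * (t - a) with hφ
  have hφmono : Monotone φ := fun s t hst => by simp only [hφ]; gcongr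
  have hφa : φ a = 0 := by simp [hφ]
  have hφb : φ b = m := by simp only [hφ]; field_simp
  have hφmem : ∀ t ∈ Icc a b, φ t ∈ Icc 0 m := fun t ht =>
    ⟨hφa ▸ hφmono ht.1, hφb ▸ hφmono ht.2⟩
  have himage : φ '' Icc a b = Icc 0 m := by
    refine Subset.antisymm (by rintro _ ⟨t, ht, rfl⟩; exact hφmem t ht) ?_
    have := intermediate_value_Icc hab.le (f := φ) (by fun_prop)
    rwa [hφa, hφb] at this
  have hdist : ∀ s ∈ Icc a b, ∀ t ∈ Icc a b, dist (γ (φ s)) (γ (φ t)) ≤ m / (b - a) * dist s t := by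
    intro s hs t ht
    have := hγ.lipschitzOnWith.dist_le_mul _ (hφmem s hs) _ (hφmem t ht)
    rw [NNReal.coe_one, one_mul] at this
    refine this.trans (le_of_eq ?_)
    rw [Real.dist_eq, Real.dist_eq, show φ s - φ t = m / (b - a) * (s - t) by simp only [hφ]; ring,
      abs_mul, abs_of_pos (show 0 < m / (b - a) by positivity)]
  refine ⟨γ ∘ φ, by simp [hφa, h0], by simp [hφb, h1], ?_, hdist, ?_⟩
  · rw [eVariationOn.comp_eq_of_monotoneOn γ φ (hφmono.monotoneOn _), himage,
      hasUnitSpeedOn_Icc_iff.1 hγ 0 m le_rfl hm0.le le_rfl, sub_zero]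
  · intro t ht
    have := hdist t ht a ⟨le_rfl, hab.le⟩
    rw [hφa, h0] at this
    refine this.trans ?_
    rw [Real.dist_eq, abs_of_nonneg (by linarith [ht.1]), div_mul_eq_mul_div, div_le_iff₀ hba]
    gcongr
    exact ht.2

/-- A polygonal curve: points `p 0, p 1, …` with `dist (p i) (p (i + 1)) < m i` are joined
consecutively by curves of length exactly `m i` and constant speed, in equal times `h`. -/
theorem IsLengthMetric.exists_polygonal (hX : IsLengthMetric X) {x₀ y₀ : X} {p : ℕ → X} {m : ℕ → ℝ}
    {K h : ℝ} (N : ℕ) (hh : 0 < h) (hm : ∀ i < N, dist (p i) (p (i + 1)) < m i)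
    (hm' : ∀ i < N, m i ≤ dist x₀ y₀) (hK : ∀ i < N, m i ≤ K * h) :
    ∃ g : ℝ → X, g (N * h) = p N ∧
      eVariationOn g (Icc 0 (N * h)) = ENNReal.ofReal (∑ i ∈ Finset.range N, m i) ∧
      (∀ s ∈ Icc 0 (N * h), ∀ t ∈ Icc 0 (N * h), dist (g s) (g t) ≤ K * dist s t) ∧
      ∀ i < N, ∀ t ∈ Icc (i * h) ((i + 1) * h), dist (g t) (p i) ≤ m i := by
  induction N with
  | zero =>
    refine ⟨fun _ => p 0, rfl, ?_, ?_, by simp⟩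
    · rw [eVariationOn.constant_on]
      · simp
      · exact (subsingleton_singleton (a := p 0)).anti (by rintro _ ⟨t, -, rfl⟩; rfl)
    · intro s hs t ht
      simp only [Nat.cast_zero, zero_mul, Icc_self, mem_singleton_iff] at hs ht
      simp [hs, ht]
  | succ N ih =>
    obtain ⟨g, hg1, hg2, hg3, hg4⟩ := ih (fun i hi => hm i (hi.trans N.lt_succ_self))
      (fun i hi => hm' i (hi.trans N.lt_succ_self)) (fun i hi => hK i (hi.trans N.lt_succ_self))
    have hN : (N : ℝ) * h < (N + 1 : ℝ) * h := by gcongr; linarith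
    have hN0 : 0 ≤ (N : ℝ) * h := by positivity
    obtain ⟨k, hk0, hk1, hk2, hk3, hk4⟩ := hX.exists_constant_speed (hm N N.lt_succ_self)
      (hm' N N.lt_succ_self) hN
    have hm0 : 0 ≤ m N := dist_nonneg.trans (hm N N.lt_succ_self).le
    have hNh : ((N : ℝ) + 1) * h - N * h = h := by ring
    have hk3' : ∀ s ∈ Icc (N * h) ((N + 1 : ℝ) * h), ∀ t ∈ Icc (N * h) ((N + 1 : ℝ) * h),
        dist (k s) (k t) ≤ K * dist s t := by
      intro s hs t ht
      refine (hk3 s hs t ht).trans ?_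
      gcongr
      rw [hNh, div_le_iff₀ hh]
      exact hK N N.lt_succ_self
    set f : ℝ → X := fun t => if t ≤ N * h then g t else k t with hf
    have hfl : ∀ t, t ≤ N * h → f t = g t := fun t ht => if_pos ht
    have hfr : ∀ t, N * h ≤ t → f t = k t := by
      intro t ht
      simp only [hf]
      split_ifs with ht'
      · rw [le_antisymm ht' ht, hg1, hk0]
      · rfl
    have hlip : ∀ s ∈ Icc 0 ((N + 1 : ℝ) * h), ∀ t ∈ Icc 0 ((N + 1 : ℝ) * h), s ≤ t →
        dist (f s) (f t) ≤ K * dist s t := by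
      intro s hs t ht hst
      rcases le_total t (N * h) with htN | htN
      · rw [hfl s (hst.trans htN), hfl t htN]
        exact hg3 s ⟨hs.1, hst.trans htN⟩ t ⟨ht.1, htN⟩
      rcases le_total (N * h) s with hsN | hsN
      · rw [hfr s hsN, hfr t htN]
        exact hk3' s ⟨hsN, hs.2⟩ t ⟨htN, ht.2⟩
      rw [hfl s hsN, hfr t htN]
      have h1 := hg3 s ⟨hs.1, hsN⟩ (N * h) ⟨hN0, le_rfl⟩
      have h2 := hk3' (N * h) ⟨le_rfl, hN.le⟩ t ⟨htN, ht.2⟩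
      have h3 := dist_triangle (g s) (p N) (k t)
      rw [hg1] at h1
      rw [hk0] at h2
      rw [Real.dist_eq, abs_sub_comm, abs_of_nonneg (by linarith)] at h1 h2 ⊢
      linarith
    refine ⟨f, ?_, ?_, ?_, ?_⟩
    · push_cast
      rw [hfr _ hN.le, hk1]
    · push_cast
      have := eVariationOn.Icc_add_Icc f hN0 hN.le (mem_univ _)
      simp only [univ_inter] at this
      rw [← this, Finset.sum_range_succ, ENNReal.ofReal_add _ hm0, ← hg2, ← hk2]
      · congr 1
        · exact eVariationOn.congr fun t ht => hfl t ht.2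
        · exact eVariationOn.congr fun t ht => hfr t ht.1
      · exact Finset.sum_nonneg fun i hi => dist_nonneg.trans
          (hm i ((Finset.mem_range.1 hi).trans N.lt_succ_self)).le
    · push_cast
      intro s hs t ht
      rcases le_total s t with hst | hst
      · exact hlip s hs t ht hst
      · rw [dist_comm, dist_comm s]
        exact hlip t ht s hs hst
    · intro i hi t ht
      rcases Nat.lt_succ_iff_lt_or_eq.1 hi with hi | rfl
      · rw [hfl]
        · exact hg4 i hi t ht
        · refine ht.2.trans ?_
          gcongr
          exact_mod_cast hi
      · rw [hfr t ht.1]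
        exact hk4 t ht

/-- A length space all of whose closed balls of radius `3` are compact is proper. -/
theorem IsLengthMetric.properSpace (hX : IsLengthMetric X)
    (h3 : ∀ x : X, IsCompact (closedBall x 3)) : ProperSpace X := by
  have key : ∀ (x : X) (n : ℕ), IsCompact (closedBall x n) := by
    intro x n
    induction n with
    | zero => simp
    | succ n ih =>
      obtain ⟨t, -, htf, ht⟩ := ih.finite_cover_balls one_pos
      refine IsCompact.of_isClosed_subset (htf.isCompact_biUnion fun y _ => h3 y)
        isClosed_closedBall ?_
      intro z hz
      -- An almost shortest curve from `x` to `z` meets the ball of radius `n` at distance `≤ 2`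
      -- from `z`.
      obtain ⟨w, hw, hwz⟩ : ∃ w ∈ closedBall x (n : ℝ), dist w z ≤ 2 := by
        push_cast at hz
        rw [mem_closedBall, dist_comm] at hz
        obtain ⟨l, γ, hl, hl', rfl, rfl, hγ⟩ := hX.exists_hasUnitSpeedOn
          (show dist x z < (n : ℝ) + 2 by linarith)
        have hn : (0 : ℝ) ≤ n := n.cast_nonneg
        have hmem : min l n ∈ Icc 0 l := ⟨le_min hl hn, min_le_left _ _⟩
        refine ⟨γ (min l n), ?_, ?_⟩
        · have := hγ.lipschitzOnWith.dist_le_mul _ hmem 0 ⟨le_rfl, hl⟩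
          rw [NNReal.coe_one, one_mul, Real.dist_eq, sub_zero, abs_of_nonneg hmem.1] at this
          exact this.trans (min_le_right _ _)
        · have := hγ.lipschitzOnWith.dist_le_mul _ hmem l ⟨hl, le_rfl⟩
          rw [NNReal.coe_one, one_mul, dist_comm (min l (n : ℝ)), Real.dist_eq,
            abs_of_nonneg (sub_nonneg.2 hmem.2)] at this
          refine this.trans ?_
          rcases min_choice l (n : ℝ) with h | h <;> rw [h] <;> linarith
      obtain ⟨y, hy, hwy⟩ := mem_iUnion₂.1 (ht hw)
      refine mem_iUnion₂.2 ⟨y, hy, ?_⟩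
      rw [mem_ball] at hwy
      rw [mem_closedBall, dist_comm]
      have := dist_triangle_left y z w
      linarith
  refine ⟨fun x r => ?_⟩
  obtain ⟨n, hn⟩ := exists_nat_ge r
  exact (key x n).of_isClosed_subset isClosed_closedBall (closedBall_subset_closedBall hn)

end LengthSpace

/-! ### Dilatations and the tangent distance -/

namespace DilationField

variable {X : Type*} [MetricSpace X] {D : DilationField X} {A B : ℝ} {d : X → X → X → ℝ}
  {ι : Type*} {l : Filter ι} {e : ι → ℝ} {y u v : ι → X} {x a b : X} {ε μ : ℝ}

theorem mem_dom_of_le (hε : ε ≤ 1) : a ∈ D.dom ε x ↔ a ∈ D.U x := by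
  simp [dom, hε, not_lt.2 hε]

theorem mem_dom_of_gt (hε : 1 < ε) : a ∈ D.dom ε x ↔ a ∈ D.W ε x := by
  simp [dom, hε, not_le.2 hε]

theorem injOn_δ (hε : 0 < ε) (hε1 : ε ≤ 1) : InjOn (D.δ ε x) (D.U x) :=
  injOn_iff_injective.2 (D.embedding_of_le ε x hε hε1).injective

theorem AxiomA2.mem_U (h2 : D.AxiomA2) (hμ : 0 < μ) (hμ1 : μ ≤ 1) (ha : a ∈ D.U x) :
    D.δ μ x a ∈ D.U x := by
  have := (h2 x 1 one_pos μ hμ a ha ((mem_dom_of_le hμ1).2 ha)).1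
  rw [one_mul, mem_dom_of_le le_rfl, mem_dom_of_le hμ1] at this
  exact this.2 ha

theorem AxiomA2.δ_δ (h2 : D.AxiomA2) (hε : 0 < ε) (hε1 : ε ≤ 1) (hμ : 0 < μ) (hμ1 : μ ≤ 1)
    (ha : a ∈ D.U x) : D.δ ε x (D.δ μ x a) = D.δ (ε * μ) x a :=
  (h2 x ε hε μ hμ a ha ((mem_dom_of_le hμ1).2 ha)).2
    ((mem_dom_of_le hε1).2 (h2.mem_U hμ hμ1 ha))

theorem AxiomA1.tendsto_δ (h1 : D.AxiomA1) (he : Tendsto e l (𝓝 ε)) (hy : Tendsto y l (𝓝 x))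
    (hu : Tendsto u l (𝓝 a)) (hmem : ∀ᶠ i in l, (e i, y i, u i) ∈ D.totalDom)
    (ha : (ε, x, a) ∈ D.totalDom) :
    Tendsto (fun i => D.δ (e i) (y i) (u i)) l (𝓝 (D.δ ε x a)) :=
  (h1.continuousOn _ ha).tendsto.comp
    (tendsto_nhdsWithin_iff.2 ⟨he.prodMk_nhds (hy.prodMk_nhds hu), hmem⟩)

/-- The dilatations shrink to the base point locally uniformly: the continuous extension of
`(ε, x, y) ↦ δ^x_ε y` takes the value `x` at `ε = 0`. -/
theorem AxiomA1.tendsto_δ_zero (h1 : D.AxiomA1) (he : Tendsto e l (𝓝[>] 0))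
    (hy : Tendsto y l (𝓝 x)) (hu : Tendsto u l (𝓝 a)) (hmem : ∀ᶠ i in l, u i ∈ D.U (y i))
    (ha : a ∈ D.U x) :
    Tendsto (fun i => D.δ (e i) (y i) (u i)) l (𝓝 x) := by
  obtain ⟨F, hF, hFδ⟩ := h1.extension
  have hle : ∀ᶠ ε : ℝ in 𝓝[>] 0, 0 < ε ∧ ε ≤ 1 := Ioc_mem_nhdsGT one_pos
  have hdom : ∀ {ε : ℝ} {x a : X}, 0 < ε ∧ ε ≤ 1 → a ∈ D.U x → (ε, x, a) ∈ D.totalDom :=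
    fun hε ha => ⟨hε.1, (mem_dom_of_le hε.2).2 ha⟩
  have hpath : Tendsto (fun ε : ℝ => (ε, x, a)) (𝓝[>] 0) (𝓝 (0, x, a)) :=
    (tendsto_nhdsWithin_of_tendsto_nhds tendsto_id).prodMk_nhds tendsto_const_nhds
  have hcl : (0, x, a) ∈ closure D.totalDom :=
    mem_closure_of_tendsto hpath (hle.mono fun ε hε => hdom hε ha)
  have hF0 : F (0, x, a) = x := by
    have h : Tendsto (fun ε : ℝ => F (ε, x, a)) (𝓝[>] 0) (𝓝 (F (0, x, a))) :=
      (hF _ hcl).tendsto.comp (tendsto_nhdsWithin_iff.2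
        ⟨hpath, hle.mono fun ε hε => subset_closure (hdom hε ha)⟩)
    refine tendsto_nhds_unique (h.congr' ?_) (h1.tendsto x a ha)
    exact hle.mono fun ε hε => hFδ _ (hdom hε ha)
  have hev : ∀ᶠ i in l, (e i, y i, u i) ∈ D.totalDom := by
    filter_upwards [he.eventually hle, hmem] with i hi hui using hdom hi hui
  have h : Tendsto (fun i => F (e i, y i, u i)) l (𝓝 (F (0, x, a))) :=
    (hF _ hcl).tendsto.comp (tendsto_nhdsWithin_iff.2
      ⟨(he.mono_right nhdsWithin_le_nhds).prodMk_nhds (hy.prodMk_nhds hu),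
        hev.mono fun i hi => subset_closure hi⟩)
  rw [hF0] at h
  exact h.congr' (hev.mono fun i hi => hFδ _ hi)

/-- The rescaled distance `(1 / ε) d(δ^x_ε u, δ^x_ε v)`. -/
noncomputable def rescaledDist (D : DilationField X) (ε : ℝ) (x u v : X) : ℝ :=
  1 / ε * dist (D.δ ε x u) (D.δ ε x v)

/-- The tangent distance at `x`, as the limit of the rescaled distances. Contrary to the distance
`d^x` of A3, it is a genuine limit on all of `U x`, not only on the ball of radius `A`. -/
noncomputable def tangentDist (D : DilationField X) (x u v : X) : ℝ :=
  limUnder (𝓝[>] 0) fun ε => D.rescaledDist ε x u v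

theorem AxiomA2.rescaledDist_δ (h2 : D.AxiomA2) (hε : 0 < ε) (hεμ : ε ≤ μ) (hμ : 0 < μ)
    (hμ1 : μ ≤ 1) (ha : a ∈ D.U x) (hb : b ∈ D.U x) :
    D.rescaledDist (ε / μ) x (D.δ μ x a) (D.δ μ x b) = μ * D.rescaledDist ε x a b := by
  have h1 : ε / μ ≤ 1 := (div_le_one hμ).2 hεμ
  rw [rescaledDist, rescaledDist, h2.δ_δ (by positivity) h1 hμ hμ1 ha,
    h2.δ_δ (by positivity) h1 hμ hμ1 hb, div_mul_cancel₀ _ hμ.ne']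
  field_simp

/-- On balls of radius `A`, the convergence of the rescaled distances is joint in all variables. -/
theorem IsStrongDilatationStructure.tendsto_rescaledDist_ball
    (hD : D.IsStrongDilatationStructure A B d) (he : Tendsto e l (𝓝[>] 0))
    (hy : Tendsto y l (𝓝 x)) (hu : Tendsto u l (𝓝 a)) (hv : Tendsto v l (𝓝 b))
    (ha : a ∈ ball x A) (hb : b ∈ ball x A) :
    Tendsto (fun i => D.rescaledDist (e i) (y i) (u i) (v i)) l (𝓝 (d x a b)) := by
  have hmem : ∀ {w : ι → X} {c : X}, Tendsto w l (𝓝 c) → c ∈ ball x A →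
      ∀ᶠ i in l, w i ∈ closedBall (y i) A := fun hw hc => by
    filter_upwards [(hw.dist hy).eventually_lt_const hc] with i hi using hi.le
  have hyK : ∀ᶠ i in l, y i ∈ closedBall x 3 := hy (closedBall_mem_nhds x (by norm_num))
  have hU := hD.a0.closedBall_subset
  rw [Metric.tendsto_nhds]
  intro η hη
  obtain ⟨ε₀, hε₀, h⟩ := hD.a3.tendsto _ (hD.compact_closedBall x) (η / 4) (by linarith)
  -- `ε'` is a fixed scale, through which the limits at the points `y i` and `x` are compared.
  obtain ⟨ε', hε', hε'1⟩ : ∃ ε' ∈ Ioo 0 ε₀, ε' ≤ 1 :=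
    ⟨min (ε₀ / 2) 1, ⟨by positivity, (min_le_left _ _).trans_lt (by linarith)⟩, min_le_right _ _⟩
  have hlim : Tendsto (fun i => D.rescaledDist ε' (y i) (u i) (v i)) l
      (𝓝 (D.rescaledDist ε' x a b)) := by
    have hδ : ∀ {w : ι → X} {c : X}, Tendsto w l (𝓝 c) → c ∈ ball x A →
        Tendsto (fun i => D.δ ε' (y i) (w i)) l (𝓝 (D.δ ε' x c)) := fun hw hc => by
      refine hD.a1.tendsto_δ tendsto_const_nhds hy hw ?_
        ⟨hε'.1, (mem_dom_of_le hε'1).2 (hU x (ball_subset_closedBall hc))⟩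
      filter_upwards [hmem hw hc] with i hi using ⟨hε'.1, (mem_dom_of_le hε'1).2 (hU _ hi)⟩
    exact ((hδ hu ha).dist (hδ hv hb)).const_mul _
  filter_upwards [hmem hu ha, hmem hv hb, hyK, he (Ioo_mem_nhdsGT hε₀),
    Metric.tendsto_nhds.1 hlim (η / 4) (by linarith)] with i hui hvi hyi hei hi
  have h1 := h _ hei _ hyi _ hui _ hvi
  have h2 := h _ hε' _ hyi _ hui _ hvi
  have h3 := h _ hε' x (mem_closedBall_self (by norm_num)) a (ball_subset_closedBall ha) b
    (ball_subset_closedBall hb)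
  simp only [Real.dist_eq, rescaledDist, abs_le, abs_lt] at *
  constructor <;> linarith [h1.1, h1.2, h2.1, h2.2, h3.1, h3.2, hi.1, hi.2]

theorem AxiomA1.exists_δ_mem_ball (h1 : D.AxiomA1) (hA : 0 < A) (ha : a ∈ D.U x) (hb : b ∈ D.U x) :
    ∃ μ ∈ Ioo (0 : ℝ) 1, D.δ μ x a ∈ ball x A ∧ D.δ μ x b ∈ ball x A :=
  (((h1.tendsto x a ha).eventually (ball_mem_nhds x hA)).and
    ((h1.tendsto x b hb).eventually (ball_mem_nhds x hA)) |>.and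
    (Ioo_mem_nhdsGT one_pos)).exists.imp fun _ h => ⟨h.2, h.1⟩

theorem IsStrongDilatationStructure.tendsto_rescaledDist_of_δ_mem_ball
    (hD : D.IsStrongDilatationStructure A B d) (he : Tendsto e l (𝓝[>] 0))
    (hy : Tendsto y l (𝓝 x)) (hu : Tendsto u l (𝓝 a)) (hv : Tendsto v l (𝓝 b))
    (huU : ∀ᶠ i in l, u i ∈ D.U (y i)) (hvU : ∀ᶠ i in l, v i ∈ D.U (y i))
    (ha : a ∈ D.U x) (hb : b ∈ D.U x) (hμ : μ ∈ Ioo (0 : ℝ) 1)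
    (haμ : D.δ μ x a ∈ ball x A) (hbμ : D.δ μ x b ∈ ball x A) :
    Tendsto (fun i => D.rescaledDist (e i) (y i) (u i) (v i)) l
      (𝓝 (1 / μ * d x (D.δ μ x a) (D.δ μ x b))) := by
  have hδ : ∀ {w : ι → X} {c : X}, Tendsto w l (𝓝 c) → (∀ᶠ i in l, w i ∈ D.U (y i)) →
      c ∈ D.U x → Tendsto (fun i => D.δ μ (y i) (w i)) l (𝓝 (D.δ μ x c)) := fun hw hwU hc => by
    refine hD.a1.tendsto_δ tendsto_const_nhds hy hw ?_ ⟨hμ.1, (mem_dom_of_le hμ.2.le).2 hc⟩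
    filter_upwards [hwU] with i hi using ⟨hμ.1, (mem_dom_of_le hμ.2.le).2 hi⟩
  have hdiv : Tendsto (fun i => e i / μ) l (𝓝[>] 0) := by
    rw [tendsto_nhdsWithin_iff] at he ⊢
    refine ⟨by simpa using he.1.div_const μ, ?_⟩
    filter_upwards [he.2] with i hi using div_pos hi hμ.1
  have key := (hD.tendsto_rescaledDist_ball hdiv hy (hδ hu huU ha) (hδ hv hvU hb) haμ
    hbμ).const_mul (1 / μ)
  refine key.congr' ?_
  filter_upwards [huU, hvU, he (Ioc_mem_nhdsGT hμ.1)] with i hui hvi hei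
  rw [hD.a2.rescaledDist_δ hei.1 hei.2 hμ.1 hμ.2.le hui hvi, ← mul_assoc,
    one_div_mul_cancel hμ.1.ne', one_mul]

theorem IsStrongDilatationStructure.tangentDist_eq
    (hD : D.IsStrongDilatationStructure A B d) (ha : a ∈ D.U x) (hb : b ∈ D.U x)
    (hμ : μ ∈ Ioo (0 : ℝ) 1) (haμ : D.δ μ x a ∈ ball x A) (hbμ : D.δ μ x b ∈ ball x A) :
    D.tangentDist x a b = 1 / μ * d x (D.δ μ x a) (D.δ μ x b) :=
  Tendsto.limUnder_eq (hD.tendsto_rescaledDist_of_δ_mem_ball tendsto_id tendsto_const_nhds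
    tendsto_const_nhds tendsto_const_nhds (.of_forall fun _ => ha) (.of_forall fun _ => hb)
    ha hb hμ haμ hbμ)

theorem IsStrongDilatationStructure.A_pos (hD : D.IsStrongDilatationStructure A B d) : 0 < A :=
  one_pos.trans hD.a0.one_lt

/-- The rescaled distances converge to the tangent distance, jointly in all variables. -/
theorem IsStrongDilatationStructure.tendsto_rescaledDist
    (hD : D.IsStrongDilatationStructure A B d) (he : Tendsto e l (𝓝[>] 0))
    (hy : Tendsto y l (𝓝 x)) (hu : Tendsto u l (𝓝 a)) (hv : Tendsto v l (𝓝 b))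
    (huU : ∀ᶠ i in l, u i ∈ D.U (y i)) (hvU : ∀ᶠ i in l, v i ∈ D.U (y i))
    (ha : a ∈ D.U x) (hb : b ∈ D.U x) :
    Tendsto (fun i => D.rescaledDist (e i) (y i) (u i) (v i)) l (𝓝 (D.tangentDist x a b)) := by
  obtain ⟨μ, hμ, haμ, hbμ⟩ := hD.a1.exists_δ_mem_ball hD.A_pos ha hb
  rw [hD.tangentDist_eq ha hb hμ haμ hbμ]
  exact hD.tendsto_rescaledDist_of_δ_mem_ball he hy hu hv huU hvU ha hb hμ haμ hbμ

theorem IsStrongDilatationStructure.tangentDist_nonneg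
    (hD : D.IsStrongDilatationStructure A B d) (ha : a ∈ D.U x) (hb : b ∈ D.U x) :
    0 ≤ D.tangentDist x a b := by
  obtain ⟨μ, hμ, haμ, hbμ⟩ := hD.a1.exists_δ_mem_ball hD.A_pos ha hb
  rw [hD.tangentDist_eq ha hb hμ haμ hbμ]
  exact mul_nonneg (one_div_nonneg.2 hμ.1.le)
    (hD.a3.nonneg x _ (ball_subset_closedBall haμ) _ (ball_subset_closedBall hbμ))

theorem IsStrongDilatationStructure.tangentDist_eq_zero_iff
    (hD : D.IsStrongDilatationStructure A B d) (ha : a ∈ D.U x) (hb : b ∈ D.U x) :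
    D.tangentDist x a b = 0 ↔ a = b := by
  obtain ⟨μ, hμ, haμ, hbμ⟩ := hD.a1.exists_δ_mem_ball hD.A_pos ha hb
  rw [hD.tangentDist_eq ha hb hμ haμ hbμ, mul_eq_zero,
    or_iff_right (one_div_ne_zero hμ.1.ne'),
    hD.a3.eq_zero_iff x _ (ball_subset_closedBall haμ) _ (ball_subset_closedBall hbμ)]
  exact (injOn_δ hμ.1 hμ.2.le).eq_iff ha hb

theorem IsStrongDilatationStructure.tendsto_tangentDist
    (hD : D.IsStrongDilatationStructure A B d) (hu : Tendsto u l (𝓝 a)) (hv : Tendsto v l (𝓝 b))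
    (huU : ∀ᶠ i in l, u i ∈ D.U x) (hvU : ∀ᶠ i in l, v i ∈ D.U x)
    (ha : a ∈ D.U x) (hb : b ∈ D.U x) :
    Tendsto (fun i => D.tangentDist x (u i) (v i)) l (𝓝 (D.tangentDist x a b)) := by
  have key : Tendsto (fun p : ι × ℝ => D.rescaledDist p.2 x (u p.1) (v p.1)) (l ×ˢ 𝓝[>] 0)
      (𝓝 (D.tangentDist x a b)) :=
    hD.tendsto_rescaledDist tendsto_snd tendsto_const_nhds (hu.comp tendsto_fst)
      (hv.comp tendsto_fst) (tendsto_fst.eventually huU) (tendsto_fst.eventually hvU) ha hb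
  rw [Metric.tendsto_nhds]
  intro η hη
  have h := Filter.Eventually.curry (Metric.tendsto_nhds.1 key (η / 2) (by linarith))
  filter_upwards [h, huU, hvU] with i hi hui hvi
  refine lt_of_le_of_lt ?_ (half_lt_self hη)
  exact le_of_tendsto ((hD.tendsto_rescaledDist tendsto_id tendsto_const_nhds tendsto_const_nhds
    tendsto_const_nhds (.of_forall fun _ => hui) (.of_forall fun _ => hvi) hui hvi).dist
    tendsto_const_nhds) (hi.mono fun ε hε => le_of_lt hε)

/-! ### The limit of the length functionals and the lower bound -/

/-- The limit functional: the maximum of the length of the curve with respect to the tangent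
distance and of half of its Lipschitz constant, expressed as the least common bound of the two.
The second quantity appears since the curves in the domain of `l_ε` have a Lipschitz constant of
at most twice their length, whereas the length may drop in the limit. -/
noncomputable def limitLength (D : DilationField X) (z : X × C(I, X)) : ℝ≥0∞ :=
  sInf {M | (∀ (n : ℕ) (t : ℕ → I), Monotone t → ∑ i ∈ Finset.range n,
      ENNReal.ofReal (D.tangentDist z.1 (z.2 (t (i + 1))) (z.2 (t i))) ≤ M) ∧
    ∀ s t, ENNReal.ofReal (D.tangentDist z.1 (z.2 s) (z.2 t)) ≤ 2 * M * edist s t}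

theorem ofReal_rescaledDist (hε : 0 < ε) : ENNReal.ofReal (D.rescaledDist ε x a b) =
    (ENNReal.ofReal ε)⁻¹ * edist (D.δ ε x a) (D.δ ε x b) := by
  rw [rescaledDist, ENNReal.ofReal_mul (by positivity), edist_dist, one_div,
    ENNReal.ofReal_inv_of_pos hε]

/-- The liminf inequality of Gamma-convergence: both the sums over partitions and the Lipschitz
quotients of the rescaled curves converge to those of the limit curve. -/
theorem IsStrongDilatationStructure.limitLength_le_liminf
    (hD : D.IsStrongDilatationStructure A B d) {z : X × C(I, X)} (hz : ∀ t, z.2 t ∈ D.U z.1)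
    {ε : ℕ → ℝ} (hε : ∀ n, ε n ∈ Ioo (0 : ℝ) 1) (hε0 : Tendsto ε atTop (𝓝 0))
    {w : ℕ → X × C(I, X)} (hw : ∀ n, w n ∈ D.curveDomain (ε n)) (hwz : Tendsto w atTop (𝓝 z)) :
    D.limitLength z ≤ liminf (fun n => D.rescaledLength (ε n) (w n)) atTop := by
  have he : Tendsto ε atTop (𝓝[>] 0) :=
    tendsto_nhdsWithin_iff.2 ⟨hε0, .of_forall fun n => (hε n).1⟩
  have hw2 : ∀ t, Tendsto (fun n => (w n).2 t) atTop (𝓝 (z.2 t)) := fun t =>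
    ((continuous_eval_const t).tendsto _).comp hwz.snd_nhds
  have hlim : ∀ s t, Tendsto
      (fun n => ENNReal.ofReal (D.rescaledDist (ε n) (w n).1 ((w n).2 s) ((w n).2 t))) atTop
      (𝓝 (ENNReal.ofReal (D.tangentDist z.1 (z.2 s) (z.2 t)))) := fun s t =>
    ENNReal.tendsto_ofReal (hD.tendsto_rescaledDist he hwz.fst_nhds (hw2 s) (hw2 t)
      (.of_forall fun n => (hw n).1 s) (.of_forall fun n => (hw n).1 t) (hz s) (hz t))
  refine le_of_forall_gt_imp_ge_of_dense fun M hM => ?_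
  have hfreq : ∃ᶠ n in atTop, D.rescaledLength (ε n) (w n) < M :=
    frequently_lt_of_liminf_lt (by isBoundedDefault) hM
  refine sInf_le ⟨fun n t ht => ?_, fun s t => ?_⟩
  · refine le_of_tendsto_of_frequently (tendsto_finsetSum _ fun i _ => hlim _ _)
      (hfreq.mono fun k hk => le_trans ?_ hk.le)
    simp only [ofReal_rescaledDist (hε k).1, ← Finset.mul_sum]
    exact mul_le_mul_right (eVariationOn.sum_le ht fun i => mem_univ _) _
  · refine le_of_tendsto_of_frequently (hlim s t) (hfreq.mono fun k hk => ?_)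
    obtain ⟨K, hK, hKle⟩ := (hw k).2
    rw [ofReal_rescaledDist (hε k).1]
    calc _ ≤ (ENNReal.ofReal (ε k))⁻¹ * (K * edist s t) := by gcongr; exact hK s t
      _ ≤ (ENNReal.ofReal (ε k))⁻¹ *
          (2 * curveLength (fun t => D.δ (ε k) (w k).1 ((w k).2 t)) * edist s t) := by gcongr
      _ = 2 * D.rescaledLength (ε k) (w k) * edist s t := by rw [rescaledLength]; ring
      _ ≤ 2 * M * edist s t := by gcongr

end DilationField

/-! ### Recovery sequences -/

namespace DilationField

variable {X : Type*} [MetricSpace X] {D : DilationField X} {A B : ℝ} {d : X → X → X → ℝ}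
  {x : X} {ε : ℝ}

/-- Points near `δ^x_ε p`, at the scale `ε`, can be pulled back by `δ^x_ε` to points near `p`,
uniformly for `p` in a compact subset of `U x`. -/
theorem IsStrongDilatationStructure.exists_preimage_near [ProperSpace X]
    (hD : D.IsStrongDilatationStructure A B d) {C : Set X} (hC : IsCompact C) (hCU : C ⊆ D.U x)
    {η : ℝ} (hη : 0 < η) :
    ∃ s > 0, ∀ᶠ ε in 𝓝[>] (0 : ℝ), ∀ p ∈ C, ∀ y, dist y (D.δ ε x p) ≤ ε * s →
      ∃ u ∈ D.U x, dist u p < η ∧ D.δ ε x u = y := by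
  by_contra! hcon
  -- Otherwise there is a sequence of points without such preimages, at scales tending to `0`.
  have hpos : ∀ n : ℕ, (0 : ℝ) < 1 / (n + 1) := fun n => Nat.one_div_pos_of_nat
  have hseq : ∀ n : ℕ, ∃ e ∈ Ioo (0 : ℝ) (1 / (n + 1)), ∃ p ∈ C, ∃ y,
      dist y (D.δ e x p) ≤ e * (1 / (n + 1)) ∧ ∀ u ∈ D.U x, dist u p < η → D.δ e x u ≠ y := by
    intro n
    obtain ⟨e, he, he'⟩ := ((hcon _ (hpos n)).and_eventually (Ioo_mem_nhdsGT (hpos n))).exists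
    exact ⟨e, he', he⟩
  choose e' he' p' hp' y' hy' hne' using hseq
  obtain ⟨a, ha, φ, hφ, hpa⟩ := hC.tendsto_subseq hp'
  set e : ℕ → ℝ := e' ∘ φ with hedef
  set p : ℕ → X := p' ∘ φ with hpdef
  set y : ℕ → X := y' ∘ φ with hydef
  have hs : Tendsto (fun n => 1 / ((φ n : ℝ) + 1)) atTop (𝓝 0) :=
    tendsto_one_div_add_atTop_nhds_zero_nat.comp hφ.tendsto_atTop
  have he0 : ∀ n, 0 < e n := fun n => (he' (φ n)).1
  have he : Tendsto e atTop (𝓝[>] 0) := by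
    refine tendsto_nhdsWithin_iff.2 ⟨?_, .of_forall he0⟩
    exact squeeze_zero (fun n => (he0 n).le) (fun n => (he' (φ n)).2.le) hs
  have hp : ∀ n, p n ∈ D.U x := fun n => hCU (hp' (φ n))
  have hyp : ∀ n, dist (y n) (D.δ (e n) x (p n)) ≤ e n * (1 / ((φ n : ℝ) + 1)) :=
    fun n => hy' (φ n)
  have haU := hCU ha
  -- The points `y n` lie in the balls of radius `e n / μ`, hence, by A0, in the image of
  -- `δ^x_{e n / μ}`.
  set τ := D.tangentDist x x a with hτ
  have hτ0 : 0 ≤ τ := hD.tangentDist_nonneg (D.mem_U x) haU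
  obtain ⟨μ, hμ, hμτ⟩ : ∃ μ ∈ Ioo (0 : ℝ) 1, μ * (τ + 2) < 1 := by
    refine ⟨1 / (τ + 3), ⟨by positivity, ?_⟩, ?_⟩
    · rw [div_lt_one (by linarith)]; linarith
    · rw [one_div_mul_eq_div, div_lt_one (by linarith)]; linarith
  have hτlim : Tendsto (fun n => D.rescaledDist (e n) x x (p n)) atTop (𝓝 τ) :=
    hD.tendsto_rescaledDist he tendsto_const_nhds tendsto_const_nhds hpa
      (.of_forall fun _ => D.mem_U x) (.of_forall hp) (D.mem_U x) haU
  have hpre : ∀ᶠ n in atTop, ∃ q, q ∈ ball x A ∧ D.δ (e n / μ) x q = y n := by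
    filter_upwards [hτlim.eventually_lt_const (lt_add_one τ), he (Ioo_mem_nhdsGT hμ.1)] with n hn hen
    have hball : y n ∈ ball x (e n / μ) := by
      rw [mem_ball, lt_div_iff₀ hμ.1]
      have h1 : dist (D.δ (e n) x (p n)) x < e n * (τ + 1) := by
        rw [rescaledDist, hD.a1.fix _ _ (he0 n), one_div, inv_mul_lt_iff₀ (he0 n)] at hn
        rwa [dist_comm]
      have h2 := hyp n
      have h3 : 1 / ((φ n : ℝ) + 1) ≤ 1 := by
        rw [div_le_one (by positivity)]
        have : (0 : ℝ) ≤ φ n := Nat.cast_nonneg _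
        linarith
      have h4 : dist (y n) x ≤ e n * (τ + 2) := by
        have := dist_triangle (y n) (D.δ (e n) x (p n)) x
        have := mul_le_mul_of_nonneg_left h3 (he0 n).le
        linarith
      calc dist (y n) x * μ ≤ e n * (τ + 2) * μ := by gcongr; exact hμ.1.le
        _ = e n * (μ * (τ + 2)) := by ring
        _ < e n * 1 := by gcongr; exact he0 n
        _ = e n := mul_one _
    exact hD.a0.ball_subset x (e n / μ) ⟨div_pos (he0 n) hμ.1, (div_lt_one hμ.1).2 hen.2⟩ hball
  have : Nonempty X := ⟨x⟩
  obtain ⟨q, hq⟩ := hpre.choice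
  have hqU : ∀ᶠ n in atTop, q n ∈ D.U x := hq.mono fun n hn =>
    hD.a0.closedBall_subset x (ball_subset_closedBall hn.1)
  have hδp : Tendsto (fun n => D.δ μ x (p n)) atTop (𝓝 (D.δ μ x a)) :=
    hD.a1.tendsto_δ tendsto_const_nhds tendsto_const_nhds hpa
      (.of_forall fun n => ⟨hμ.1, (mem_dom_of_le hμ.2.le).2 (hp n)⟩)
      ⟨hμ.1, (mem_dom_of_le hμ.2.le).2 haU⟩
  have hδa : D.δ μ x a ∈ D.U x := hD.a2.mem_U hμ.1 hμ.2.le haU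
  have hdiv : Tendsto (fun n => e n / μ) atTop (𝓝[>] 0) := by
    rw [tendsto_nhdsWithin_iff] at he ⊢
    exact ⟨by simpa using he.1.div_const μ, .of_forall fun n => div_pos (he0 n) hμ.1⟩
  -- The preimages converge to `δ^x_μ a`, since the tangent distance of a cluster point
  -- to `δ^x_μ a` is zero.
  have hqlim : Tendsto q atTop (𝓝 (D.δ μ x a)) := by
    refine (isCompact_closedBall x A).tendsto_nhds_of_unique_mapClusterPt
      (hq.mono fun n hn => ball_subset_closedBall hn.1) fun b hb hclus => ?_
    obtain ⟨𝒰, h𝒰, hqb⟩ := mapClusterPt_iff_ultrafilter.1 hclus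
    have hbU := hD.a0.closedBall_subset x hb
    rw [← hD.tangentDist_eq_zero_iff hbU hδa]
    refine tendsto_nhds_unique (hD.tendsto_rescaledDist (hdiv.mono_left h𝒰) tendsto_const_nhds hqb
      (hδp.mono_left h𝒰) (h𝒰 hqU)
      (.of_forall fun n => hD.a2.mem_U hμ.1 hμ.2.le (hp n)) hbU hδa) ?_
    refine Tendsto.mono_left ?_ h𝒰
    have hs' : Tendsto (fun n => μ * (1 / ((φ n : ℝ) + 1))) atTop (𝓝 0) := by
      simpa using hs.const_mul μ
    refine squeeze_zero' (.of_forall fun n => ?_) ?_ hs'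
    · rw [rescaledDist]
      have := he0 n
      have := hμ.1
      positivity
    · filter_upwards [hq, he (Ioc_mem_nhdsGT hμ.1)] with n hn hen
      rw [rescaledDist, hn.2, hD.a2.δ_δ (div_pos (he0 n) hμ.1) ((div_le_one hμ.1).2 hen.2) hμ.1
        hμ.2.le (hp n), div_mul_cancel₀ _ hμ.1.ne']
      calc 1 / (e n / μ) * dist (y n) (D.δ (e n) x (p n))
          ≤ 1 / (e n / μ) * (e n * (1 / ((φ n : ℝ) + 1))) := by
            have := he0 n
            have := hμ.1
            gcongr
            exact hyp n
        _ = μ * (1 / ((φ n : ℝ) + 1)) := by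
            have := (he0 n).ne'
            have := hμ.1.ne'
            field_simp
  -- Now the `q n` themselves have preimages `u n` under `δ^x_μ`, and `u n` converges to `a`.
  have hV : ∀ᶠ n in atTop, ∃ u : D.U x, D.δ μ x u = q n := by
    have hopen := (D.isOpen_V μ x hμ.1 hμ.2.le).mem_nhds
      (D.image_of_le μ x hμ.1 hμ.2.le ▸ mem_image_of_mem _ haU)
    filter_upwards [hqlim hopen] with n hn
    rw [mem_preimage, ← D.image_of_le μ x hμ.1 hμ.2.le] at hn
    obtain ⟨u, hu, hun⟩ := hn
    exact ⟨⟨u, hu⟩, hun⟩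
  have : Nonempty (D.U x) := ⟨⟨a, haU⟩⟩
  obtain ⟨u, hu⟩ := hV.choice
  have hulim : Tendsto u atTop (𝓝 ⟨a, haU⟩) := by
    rw [(D.embedding_of_le μ x hμ.1 hμ.2.le).tendsto_nhds_iff]
    exact hqlim.congr' (hu.mono fun n hn => hn.symm)
  have hulim' : Tendsto (fun n => (u n : X)) atTop (𝓝 a) :=
    (continuous_subtype_val.tendsto _).comp hulim
  have hdist : Tendsto (fun n => dist (u n : X) (p n)) atTop (𝓝 0) := by
    simpa using hulim'.dist hpa
  obtain ⟨n, hn, hun, hqn, hen⟩ := ((hdist.eventually_lt_const hη).and (hu.and (hq.and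
    (he (Ioc_mem_nhdsGT hμ.1))))).exists
  refine hne' (φ n) (u n) (u n).2 hn ?_
  change D.δ (e n) x (u n) = y n
  rw [← hqn.2, ← hun, hD.a2.δ_δ (div_pos (he0 n) hμ.1) ((div_le_one hμ.1).2 hen.2) hμ.1
    hμ.2.le (u n).2, div_mul_cancel₀ _ hμ.1.ne']

/-- Approximation of a curve `c` in `U x` by curves in the domain of `l_ε`: these are the preimages
under `δ^x_ε` of curves that join the points `δ^x_ε (c (i / N))` consecutively and have the
prescribed lengths `ε m i`. -/
theorem IsStrongDilatationStructure.exists_polygonal_mem_curveDomain [ProperSpace X] [Nontrivial X]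
    (hD : D.IsStrongDilatationStructure A B d) (hX : IsLengthMetric X) {c : C(I, X)}
    (hc : ∀ t, c t ∈ D.U x) {η : ℝ} (hη : 0 < η) :
    ∃ s > 0, ∀ (N : ℕ) (m : ℕ → ℝ), 0 < N →
      (∀ t t' : I, dist t t' ≤ 1 / N → dist (c t) (c t') ≤ η) →
      (∀ i < N, D.tangentDist x (c (projIcc 0 1 zero_le_one (i / N)))
        (c (projIcc 0 1 zero_le_one ((i + 1 : ℕ) / N))) < m i) →
      (∀ i < N, m i ≤ s) → (∀ i < N, N * m i ≤ 2 * ∑ j ∈ Finset.range N, m j) →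
      ∀ᶠ ε in 𝓝[>] (0 : ℝ), ∃ w : C(I, X), (x, w) ∈ D.curveDomain ε ∧ dist w c ≤ 2 * η ∧
        D.rescaledLength ε (x, w) = ENNReal.ofReal (∑ i ∈ Finset.range N, m i) := by
  obtain ⟨s, hs, hlift⟩ := hD.exists_preimage_near (isCompact_range c.continuous)
    (range_subset_iff.2 hc) hη
  refine ⟨s, hs, fun N m hN hcη hm hms hmN => ?_⟩
  obtain ⟨x₀, y₀, hxy⟩ := exists_pair_ne X
  have hN0 : (0 : ℝ) < N := Nat.cast_pos.2 hN
  set p : ℕ → X := fun i => c (projIcc 0 1 zero_le_one (i / N)) with hp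
  have hclose : ∀ᶠ ε in 𝓝[>] (0 : ℝ), ∀ i ∈ Finset.range N,
      D.rescaledDist ε x (p i) (p (i + 1)) < m i := by
    rw [eventually_all_finset]
    intro i hi
    exact (hD.tendsto_rescaledDist tendsto_id tendsto_const_nhds tendsto_const_nhds
      tendsto_const_nhds (.of_forall fun _ => hc _) (.of_forall fun _ => hc _) (hc _)
      (hc _)).eventually_lt_const (hm i (Finset.mem_range.1 hi))
  filter_upwards [hlift, hclose, Ioc_mem_nhdsGT (one_pos : (0 : ℝ) < 1),
    Ioc_mem_nhdsGT (show 0 < dist x₀ y₀ / s from div_pos (dist_pos.2 hxy) hs)] with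
    ε hε hεm ⟨hε0, hε1⟩ hεs
  have hsum0 : 0 ≤ ∑ j ∈ Finset.range N, m j := Finset.sum_nonneg fun i hi =>
    (hD.tangentDist_nonneg (hc _) (hc _)).trans (hm i (Finset.mem_range.1 hi)).le
  obtain ⟨g, -, hgvar, hglip, hgdist⟩ := hX.exists_polygonal (x₀ := x₀) (y₀ := y₀)
    (p := fun i => D.δ ε x (p i)) (m := fun i => ε * m i)
    (K := 2 * (ε * ∑ j ∈ Finset.range N, m j)) (h := 1 / N) N (by positivity)
    (fun i hi => by
      have := hεm i (Finset.mem_range.2 hi)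
      rwa [rescaledDist, one_div, inv_mul_lt_iff₀ hε0] at this)
    (fun i hi => by
      have h1 := mul_le_mul_of_nonneg_left (hms i hi) hε0.le
      have h2 := (le_div_iff₀ hs).1 hεs.2
      exact h1.trans h2)
    (fun i hi => by
      rw [mul_one_div, le_div_iff₀ hN0]
      have := mul_le_mul_of_nonneg_left (hmN i hi) hε0.le
      linarith)
  rw [mul_one_div_cancel hN0.ne'] at hgvar hglip
  have hw : ∀ t : I, ∃ u : D.U x, dist (u : X) (c t) ≤ 2 * η ∧ D.δ ε x u = g t := by
    intro t
    obtain ⟨i, hi, hti⟩ : ∃ i < N, (t : ℝ) ∈ Icc (i * (1 / N : ℝ)) ((i + 1) * (1 / N)) := by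
      rcases t.2.2.lt_or_eq with ht | ht
      · refine ⟨⌊(N : ℝ) * t⌋₊, ?_, ?_, ?_⟩
        · rw [Nat.floor_lt (mul_nonneg hN0.le t.2.1)]
          nlinarith
        · rw [mul_one_div, div_le_iff₀ hN0, mul_comm (t : ℝ)]
          exact Nat.floor_le (mul_nonneg hN0.le t.2.1)
        · rw [mul_one_div, le_div_iff₀ hN0, mul_comm (t : ℝ)]
          exact (Nat.lt_floor_add_one _).le
      · refine ⟨N - 1, Nat.sub_lt hN one_pos, ?_⟩
        rw [ht, Nat.cast_pred hN, mul_one_div, mul_one_div]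
        constructor
        · rw [div_le_iff₀ hN0]; linarith
        · rw [le_div_iff₀ hN0]; linarith
    have h1 : dist (g t) (D.δ ε x (p i)) ≤ ε * s :=
      (hgdist i hi t hti).trans (mul_le_mul_of_nonneg_left (hms i hi) hε0.le)
    obtain ⟨u, hu, hup, hug⟩ := hε (p i) (mem_range_self _) (g t) h1
    refine ⟨⟨u, hu⟩, ?_, hug⟩
    have h2 : dist (p i) (c t) ≤ η := by
      refine hcη _ _ ?_
      have hmem : (i / N : ℝ) ∈ Icc (0 : ℝ) 1 := by
        refine ⟨by positivity, (div_le_one hN0).2 ?_⟩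
        exact_mod_cast hi.le
      rw [projIcc_of_mem _ hmem, Subtype.dist_eq, dist_comm, Real.dist_eq]
      have h3 := hti.1
      have h4 := hti.2
      rw [mul_one_div] at h3
      rw [add_mul, one_mul, mul_one_div] at h4
      rw [abs_of_nonneg (by linarith)]
      linarith
    have := dist_triangle u (p i) (c t)
    change dist u (c t) ≤ 2 * η
    linarith
  choose w hwc hwg using hw
  have hglip' : LipschitzWith (2 * (ε * ∑ j ∈ Finset.range N, m j)).toNNReal
      (fun t : I => g t) := by
    refine LipschitzWith.of_dist_le_mul fun t t' => ?_
    rw [Real.coe_toNNReal _ (by positivity)]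
    exact hglip t t.2 t' t'.2
  have hwcont : Continuous w := by
    rw [(D.embedding_of_le ε x hε0 hε1).continuous_iff]
    exact hglip'.continuous.congr fun t => (hwg t).symm
  have hlen : curveLength (fun t => D.δ ε x (w t)) =
      ENNReal.ofReal (ε * ∑ j ∈ Finset.range N, m j) := by
    have h1 : (fun t => D.δ ε x (w t)) = g ∘ ((↑) : I → ℝ) := funext hwg
    have h2 := eVariationOn.comp_eq_of_monotoneOn g (t := univ) ((↑) : I → ℝ)
      ((Subtype.mono_coe _).monotoneOn _)
    rw [image_univ, Subtype.range_coe] at h2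
    rw [curveLength, h1, h2, Finset.mul_sum]
    exact hgvar
  refine ⟨⟨fun t => w t, continuous_subtype_val.comp hwcont⟩,
    ⟨fun t => (w t).2, (2 * (ε * ∑ j ∈ Finset.range N, m j)).toNNReal, ?_, ?_⟩, ?_, ?_⟩
  · have h1 : (fun t => D.δ ε x (w t)) = fun t : I => g t := funext hwg
    change LipschitzWith _ (fun t => D.δ ε x (w t))
    rw [h1]
    exact hglip'
  · change _ ≤ 2 * curveLength (fun t => D.δ ε x (w t))
    rw [hlen, ENNReal.ofNNReal_toNNReal, ENNReal.ofReal_mul zero_le_two, ENNReal.ofReal_ofNat]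
  · exact (ContinuousMap.dist_le (by positivity)).2 hwc
  · change (ENNReal.ofReal ε)⁻¹ * curveLength (fun t => D.δ ε x (w t)) = _
    rw [hlen, ENNReal.ofReal_mul hε0.le, ← mul_assoc, ENNReal.inv_mul_cancel, one_mul]
    · exact (ENNReal.ofReal_pos.2 hε0).ne'
    · exact ENNReal.ofReal_ne_top

theorem tangentDist_comm (a b : X) : D.tangentDist x a b = D.tangentDist x b a := by
  simp only [tangentDist, rescaledDist, dist_comm]

theorem IsStrongDilatationStructure.exists_modulus (hD : D.IsStrongDilatationStructure A B d)
    {c : C(I, X)} (hc : ∀ t, c t ∈ D.U x) {η s : ℝ} (hη : 0 < η) (hs : 0 < s) :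
    ∃ r > 0, ∀ t t' : I, dist t t' < r →
      dist (c t) (c t') ≤ η ∧ D.tangentDist x (c t) (c t') < s := by
  have hcont : Continuous fun q : I × I => D.tangentDist x (c q.1) (c q.2) := by
    rw [continuous_iff_continuousAt]
    intro q
    exact hD.tendsto_tangentDist (c.continuous.fst'.tendsto q) (c.continuous.snd'.tendsto q)
      (.of_forall fun _ => hc _) (.of_forall fun _ => hc _) (hc _) (hc _)
  obtain ⟨r₁, hr₁, h₁⟩ := Metric.uniformContinuous_iff.1
    (CompactSpace.uniformContinuous_of_continuous c.continuous) η hη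
  obtain ⟨r₂, hr₂, h₂⟩ := Metric.uniformContinuous_iff.1
    (CompactSpace.uniformContinuous_of_continuous hcont) s hs
  refine ⟨min r₁ r₂, lt_min hr₁ hr₂, fun t t' ht => ⟨(h₁ (ht.trans_le (min_le_left _ _))).le, ?_⟩⟩
  have h := @h₂ (t, t') (t, t) (by
    rw [Prod.dist_eq, dist_self, max_eq_right dist_nonneg, dist_comm]
    exact ht.trans_le (min_le_right _ _))
  rw [(hD.tangentDist_eq_zero_iff (hc t) (hc t)).2 rfl, Real.dist_eq, sub_zero] at h
  exact (le_abs_self _).trans_lt h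

/-- Approximation of a curve `c` in `U x` by curves in the domain of `l_ε`, for all small `ε`, with
rescaled lengths that exceed the limit functional by arbitrarily little. -/
theorem IsStrongDilatationStructure.exists_near_mem_curveDomain [ProperSpace X]
    (hD : D.IsStrongDilatationStructure A B d) (hX : IsLengthMetric X) {c : C(I, X)}
    (hc : ∀ t, c t ∈ D.U x) {η : ℝ} (hη : 0 < η) :
    ∀ᶠ ε in 𝓝[>] (0 : ℝ), ∃ w : C(I, X), (x, w) ∈ D.curveDomain ε ∧ dist w c ≤ η ∧
      D.rescaledLength ε (x, w) ≤ D.limitLength (x, c) + ENNReal.ofReal η := by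
  rcases subsingleton_or_nontrivial X with hsub | hnt
  · refine .of_forall fun ε => ⟨c, ⟨hc, 0, fun s t => ?_, by simp⟩, by simpa using hη.le, ?_⟩
    · exact (edist_le_zero.2 (Subsingleton.elim _ _)).trans zero_le
    · rw [rescaledLength, curveLength, eVariationOn.constant_on subsingleton_of_subsingleton, mul_zero]
      exact zero_le
  obtain ⟨s, hs, h⟩ := hD.exists_polygonal_mem_curveDomain hX hc (half_pos hη)
  obtain ⟨r, hr, hmod⟩ := hD.exists_modulus hc (half_pos hη) hs
  have hstep : ∀ (N i : ℕ), dist (projIcc (0 : ℝ) 1 zero_le_one (i / N))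
      (projIcc 0 1 zero_le_one ((i + 1 : ℕ) / N)) ≤ 1 / N := by
    intro N i
    have := (LipschitzWith.projIcc (zero_le_one (α := ℝ))).dist_le_mul (i / N) ((i + 1 : ℕ) / N)
    refine this.trans (le_of_eq ?_)
    rw [NNReal.coe_one, one_mul, dist_comm, Real.dist_eq, ← sub_div]
    push_cast
    rw [add_sub_cancel_left, abs_of_nonneg (by positivity)]
  rcases eq_or_ne (D.limitLength (x, c)) ⊤ with htop | htop
  · -- Without a bound on the length it suffices to take all pieces of the same length `s`.
    obtain ⟨N, hN⟩ := exists_nat_one_div_lt hr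
    have hN' : (1 : ℝ) / (N + 1 : ℕ) < r := by exact_mod_cast hN
    filter_upwards [h (N + 1) (fun _ => s) N.succ_pos
      (fun t t' ht => (hmod t t' (ht.trans_lt hN')).1)
      (fun i _ => (hmod _ _ ((hstep _ i).trans_lt hN')).2) (fun _ _ => le_rfl)
      (fun _ _ => by
        rw [Finset.sum_const, Finset.card_range, nsmul_eq_mul]
        have : 0 ≤ ((N + 1 : ℕ) : ℝ) * s := by positivity
        linarith)] with ε ⟨w, hw, hwc, _⟩
    exact ⟨w, hw, by linarith, by simp [htop]⟩
  · have hlt : D.limitLength (x, c) < D.limitLength (x, c) + ENNReal.ofReal η :=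
      ENNReal.lt_add_right htop (ENNReal.ofReal_pos.2 hη).ne'
    obtain ⟨M, ⟨hM1, hM2⟩, hML⟩ := sInf_lt_iff.1 hlt
    have hMtop : M ≠ ⊤ := hML.ne_top
    lift M to ℝ≥0 using hMtop
    obtain ⟨T, hMT, hT⟩ := ENNReal.lt_iff_exists_nnreal_btwn.1 hML
    have hMT' : (M : ℝ) < T := by exact_mod_cast hMT
    have hT0 : (0 : ℝ) < T := M.coe_nonneg.trans_lt hMT'
    obtain ⟨N, hN0, hNr, hNs⟩ : ∃ N : ℕ, 0 < N ∧ (1 : ℝ) / N < r ∧ 2 * T / N ≤ s := by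
      have h1 := (tendsto_const_div_atTop_nhds_zero_nat (1 : ℝ)).eventually_lt_const hr
      have h2 := (tendsto_const_div_atTop_nhds_zero_nat (2 * T : ℝ)).eventually_lt_const hs
      obtain ⟨N, hN1, hN2, hN3⟩ := ((eventually_gt_atTop 0).and (h1.and h2)).exists
      exact ⟨N, hN1, hN2, hN3.le⟩
    have hN : (0 : ℝ) < N := Nat.cast_pos.2 hN0
    set q : ℕ → I := fun i => projIcc 0 1 zero_le_one (i / N) with hq
    have hqmono : Monotone q := fun i j hij => monotone_projIcc _ (by gcongr)
    set E : ℕ → ℝ := fun i => D.tangentDist x (c (q i)) (c (q (i + 1))) with hE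
    have hE0 : ∀ i, 0 ≤ E i := fun i => hD.tangentDist_nonneg (hc _) (hc _)
    have hEM : ∀ i, E i ≤ 2 * M / N := by
      intro i
      have h1 := hM2 (q i) (q (i + 1))
      have h2 : edist (q i) (q (i + 1)) ≤ ENNReal.ofReal (1 / N) := by
        rw [edist_dist]
        exact ENNReal.ofReal_le_ofReal (hstep N i)
      have h3 : ENNReal.ofReal (E i) ≤ ENNReal.ofReal (2 * M * (1 / N)) := by
        rw [ENNReal.ofReal_mul (by positivity), ENNReal.ofReal_mul zero_le_two,
          ENNReal.ofReal_ofNat, ENNReal.ofReal_coe_nnreal]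
        exact h1.trans (by gcongr)
      rw [ENNReal.ofReal_le_ofReal_iff (by positivity), mul_one_div] at h3
      exact h3
    have hEsum : ∑ i ∈ Finset.range N, E i ≤ M := by
      have h1 := hM1 N q hqmono
      simp only [tangentDist_comm (c (q (_ + 1)))] at h1
      rw [← ENNReal.ofReal_sum_of_nonneg fun i _ => hE0 i] at h1
      exact ENNReal.ofReal_le_coe.1 h1
    have hEsum0 : 0 ≤ ∑ i ∈ Finset.range N, E i := Finset.sum_nonneg fun i _ => hE0 i
    -- Each length is a convex combination of the least possible value `E i` and of the greatest
    -- admissible value `2 * T / N`, with weights for which the total length is `T`.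
    set S := ∑ i ∈ Finset.range N, E i with hS
    set θ := (T - S) / (2 * T - S) with hθ
    have hden : 0 < 2 * T - S := by linarith
    have hθ0 : 0 < θ := div_pos (by linarith) hden
    have hθ1 : θ ≤ 1 := (div_le_one hden).2 (by linarith)
    have hElt : ∀ i, E i < 2 * T / N := fun i => (hEM i).trans_lt (by gcongr)
    have hsum : ∑ i ∈ Finset.range N, (E i + θ * (2 * T / N - E i)) = T := by
      rw [Finset.sum_add_distrib, ← Finset.mul_sum, Finset.sum_sub_distrib, Finset.sum_const,
        Finset.card_range, nsmul_eq_mul, ← hS, mul_div_cancel₀ _ hN.ne', hθ,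
        div_mul_cancel₀ _ hden.ne']
      ring
    have hle : ∀ i, E i + θ * (2 * T / N - E i) ≤ 2 * T / N := by
      intro i
      have := mul_le_mul_of_nonneg_right hθ1 (sub_nonneg.2 (hElt i).le)
      linarith
    filter_upwards [h N (fun i => E i + θ * (2 * T / N - E i)) hN0
      (fun t t' ht => (hmod t t' (ht.trans_lt hNr)).1)
      (fun i _ => lt_add_of_pos_right _ (mul_pos hθ0 (sub_pos.2 (hElt i))))
      (fun i _ => (hle i).trans hNs)
      (fun i _ => by
        rw [hsum]
        have := mul_le_mul_of_nonneg_left (hle i) hN.le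
        rwa [mul_div_cancel₀ _ hN.ne'] at this)] with ε ⟨w, hw, hwc, hwl⟩
    refine ⟨w, hw, by linarith, ?_⟩
    rw [hwl, hsum, ENNReal.ofReal_coe_nnreal]
    exact hT.le

/-- Recovery sequences exist along every sequence `ε n → 0`, since the approximation of
`exists_near_mem_curveDomain` is available for all small `ε`. -/
theorem IsStrongDilatationStructure.exists_recovery [ProperSpace X]
    (hD : D.IsStrongDilatationStructure A B d) (hX : IsLengthMetric X) {z : X × C(I, X)}
    (hz : ∀ t, z.2 t ∈ D.U z.1) {ε : ℕ → ℝ} (hε : ∀ n, ε n ∈ Ioo (0 : ℝ) 1)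
    (hε0 : Tendsto ε atTop (𝓝 0)) :
    ∃ w : ℕ → X × C(I, X), (∀ n, w n ∈ D.curveDomain (ε n)) ∧ Tendsto w atTop (𝓝 z) ∧
      Tendsto (fun n => D.rescaledLength (ε n) (w n)) atTop (𝓝 (D.limitLength z)) := by
  have he : Tendsto ε atTop (𝓝[>] 0) :=
    tendsto_nhdsWithin_iff.2 ⟨hε0, .of_forall fun n => (hε n).1⟩
  -- `F n` measures how far a curve is from being suitable as the `n`-th term.
  set F : ℕ → X × C(I, X) → ℝ≥0∞ := fun n w =>
    max (edist w z) (D.rescaledLength (ε n) w - D.limitLength z) with hF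
  set m : ℕ → ℝ≥0∞ := fun n => ⨅ w ∈ D.curveDomain (ε n), F n w with hm
  have hm0 : Tendsto m atTop (𝓝 0) := by
    rw [ENNReal.tendsto_nhds_zero]
    intro η hη
    obtain ⟨r, hr0, hr⟩ := ENNReal.lt_iff_exists_nnreal_btwn.1 hη
    have hr0' : (0 : ℝ) < r := by exact_mod_cast hr0
    filter_upwards [he.eventually (hD.exists_near_mem_curveDomain hX hz hr0')] with
      n ⟨w, hw, hwz, hwl⟩
    refine (iInf₂_le (z.1, w) hw).trans ((max_le ?_ ?_).trans hr.le)
    · rw [Prod.edist_eq, edist_self, max_eq_right zero_le, edist_dist, ← ENNReal.ofReal_coe_nnreal]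
      exact ENNReal.ofReal_le_ofReal hwz
    · rw [ENNReal.ofReal_coe_nnreal] at hwl
      exact tsub_le_iff_left.2 hwl
  have hmtop : ∀ n, m n < ⊤ := by
    intro n
    have hconst : (fun t : I => D.δ (ε n) z.1 (ContinuousMap.const I z.1 t)) = fun _ => z.1 :=
      funext fun t => hD.a1.fix _ _ (hε n).1
    have hlen : curveLength (fun _ : I => z.1) = 0 :=
      eVariationOn.constant_on ((subsingleton_singleton (a := z.1)).anti
        (by rintro _ ⟨t, -, rfl⟩; rfl))
    have hmem : (z.1, ContinuousMap.const I z.1) ∈ D.curveDomain (ε n) := by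
      refine ⟨fun _ => D.mem_U _, 0, ?_, by simp⟩
      rw [hconst]
      exact LipschitzWith.const _
    refine (iInf₂_le _ hmem).trans_lt (max_lt (edist_lt_top _ _) ?_)
    rw [rescaledLength, hconst, hlen, mul_zero, zero_tsub]
    exact ENNReal.zero_lt_top
  have hlt : ∀ n, m n < m n + ((n : ℝ≥0∞) + 1)⁻¹ := fun n =>
    ENNReal.lt_add_right (hmtop n).ne (ENNReal.inv_ne_zero.2 (by finiteness))
  choose w hw hwF using fun n => by simpa only [hm, iInf_lt_iff, exists_prop] using hlt n
  have hF0 : Tendsto (fun n => F n (w n)) atTop (𝓝 0) := by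
    have h1 : Tendsto (fun n : ℕ => ((n : ℝ≥0∞) + 1)⁻¹) atTop (𝓝 0) := by
      have := (tendsto_add_atTop_iff_nat 1).2 ENNReal.tendsto_inv_nat_nhds_zero
      simpa using this
    have h2 := hm0.add h1
    rw [add_zero] at h2
    exact tendsto_of_tendsto_of_tendsto_of_le_of_le tendsto_const_nhds h2 (fun _ => zero_le)
      fun n => (hwF n).le
  have hwz : Tendsto w atTop (𝓝 z) := by
    rw [tendsto_iff_edist_tendsto_0]
    exact tendsto_of_tendsto_of_tendsto_of_le_of_le tendsto_const_nhds hF0 (fun _ => zero_le)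
      fun n => le_max_left _ _
  refine ⟨w, hw, hwz, tendsto_of_le_liminf_of_limsup_le
    (hD.limitLength_le_liminf hz hε hε0 hw hwz) ?_⟩
  have h1 : Tendsto (fun n => D.limitLength z + F n (w n)) atTop (𝓝 (D.limitLength z)) := by
    simpa using hF0.const_add (D.limitLength z)
  rw [← h1.limsup_eq]
  exact limsup_le_limsup (.of_forall fun n => tsub_le_iff_left.1 (le_max_right _ _))

end DilationField

/-! ### The approximate sums -/

namespace DilationField

variable {X : Type*} [MetricSpace X] {D : DilationField X} {A B : ℝ} {d : X → X → X → ℝ}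
  {x u v : X} {ε : ℝ}

/-- `Σ^x_ε(u, v) = Δ^{x'}_ε(w, v)` where `x' = δ^x_ε u` and `w = Δ^x_ε(u, x)` is the approximate
inverse of `u`, for which `δ^{x'}_ε w = x`. -/
theorem IsStrongDilatationStructure.sigma_eq_delta (hD : D.IsStrongDilatationStructure A B d)
    (hε : ε ∈ Ioo (0 : ℝ) 1) (hx : D.DeltaDefined ε x u x) (hx' : x ∈ D.U (D.δ ε x u))
    (hv : D.DeltaDefined ε (D.δ ε x u) (D.Delta ε x u x) v) :
    D.SigmaDefined ε x u v ∧
      D.Sigma ε x u v = D.Delta ε (D.δ ε x u) (D.Delta ε x u x) v := by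
  have hfix : D.δ ε x x = x := hD.a1.fix ε x hε.1
  have hW := hx.2.2
  rw [hfix] at hW
  have hε' : 1 < ε⁻¹ := (one_lt_inv₀ hε.1).2 hε.2
  have hback : D.δ ε (D.δ ε x u) (D.Delta ε x u x) = x := by
    have h := hD.a2 (D.δ ε x u) ε hε.1 ε⁻¹ (inv_pos.2 hε.1) x hx' ((mem_dom_of_gt hε').2 hW)
    rw [mul_inv_cancel₀ hε.1.ne', mem_dom_of_le le_rfl] at h
    rw [Delta, hfix, h.2 (h.1.2 hx'), hD.a1.one _ _ hx']
  have hvW := hv.2.2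
  rw [hback] at hvW
  exact ⟨⟨hx.1, hv.2.1, hvW⟩, by rw [Sigma, Delta, hback]⟩

theorem IsStrongDilatationStructure.continuousOn_delta (hD : D.IsStrongDilatationStructure A B d)
    (hε : ε ∈ Ioo (0 : ℝ) 1) {S : Set (X × X × X)}
    (hS : ∀ p ∈ S, D.DeltaDefined ε p.1 p.2.1 p.2.2) :
    ContinuousOn (fun p : X × X × X => D.Delta ε p.1 p.2.1 p.2.2) S := by
  have hε' : 1 < ε⁻¹ := (one_lt_inv₀ hε.1).2 hε.2
  intro p hp
  have hself : ∀ᶠ q in 𝓝[S] p, q ∈ S := self_mem_nhdsWithin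
  have h1 : Tendsto (fun q : X × X × X => q.1) (𝓝[S] p) (𝓝 p.1) :=
    (continuous_fst.tendsto p).mono_left nhdsWithin_le_nhds
  have h2 : Tendsto (fun q : X × X × X => q.2.1) (𝓝[S] p) (𝓝 p.2.1) :=
    (continuous_snd.fst.tendsto p).mono_left nhdsWithin_le_nhds
  have h3 : Tendsto (fun q : X × X × X => q.2.2) (𝓝[S] p) (𝓝 p.2.2) :=
    (continuous_snd.snd.tendsto p).mono_left nhdsWithin_le_nhds
  have hdom : ∀ {x u : X}, u ∈ D.U x → (ε, x, u) ∈ D.totalDom := fun hu =>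
    ⟨hε.1, (mem_dom_of_le hε.2.le).2 hu⟩
  have hdom' : ∀ q ∈ S, (ε⁻¹, D.δ ε q.1 q.2.1, D.δ ε q.1 q.2.2) ∈ D.totalDom := fun q hq =>
    ⟨inv_pos.2 hε.1, (mem_dom_of_gt hε').2 (hS q hq).2.2⟩
  exact hD.a1.tendsto_δ tendsto_const_nhds
    (hD.a1.tendsto_δ tendsto_const_nhds h1 h2 (hself.mono fun q hq => hdom (hS q hq).1)
      (hdom (hS p hp).1))
    (hD.a1.tendsto_δ tendsto_const_nhds h1 h3 (hself.mono fun q hq => hdom (hS q hq).2.1)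
      (hdom (hS p hp).2.1)) (hself.mono hdom') (hdom' p hp)

theorem isCompact_near [ProperSpace X] {K : Set X} (hK : IsCompact K) (R : ℝ) :
    IsCompact {p : X × X × X | p.1 ∈ K ∧ p.2.1 ∈ closedBall p.1 R ∧ p.2.2 ∈ closedBall p.1 R} := by
  have hb : IsCompact (cthickening R K) := hK.cthickening
  refine (hK.prod (hb.prod hb)).of_isClosed_subset ?_ ?_
  · refine (hK.isClosed.preimage continuous_fst).inter (IsClosed.inter ?_ ?_)
    · exact isClosed_le (continuous_snd.fst.dist continuous_fst) continuous_const
    · exact isClosed_le (continuous_snd.snd.dist continuous_fst) continuous_const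
  · rintro ⟨x, u, v⟩ ⟨hx, hu, hv⟩
    exact ⟨hx, mem_cthickening_of_dist_le u x R K hx hu, mem_cthickening_of_dist_le v x R K hx hv⟩

/-- Axiom A4 implies the convergence of the approximate sums. -/
theorem IsStrongDilatationStructure.convergesNear_sigma [ProperSpace X]
    (hD : D.IsStrongDilatationStructure A B d) {G : X → X → X → X}
    (hG : ConvergesNear D.DeltaDefined D.Delta G) :
    ConvergesNear D.SigmaDefined D.Sigma fun x u v => G x (G x u x) v := by
  intro K hK
  have hK₁ : IsCompact (cthickening 1 K) := hK.cthickening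
  have hKK₁ : K ⊆ cthickening 1 K := self_subset_cthickening K
  obtain ⟨R₁, hR₁, ⟨ε₁, hε₁, hdef⟩, hunif⟩ := hG _ hK₁
  set S₁ : Set (X × X × X) := {p | p.1 ∈ cthickening 1 K ∧ p.2.1 ∈ closedBall p.1 R₁ ∧
    p.2.2 ∈ closedBall p.1 R₁} with hS₁
  have hdefS₁ : ∀ ε ∈ Ioo 0 ε₁, ∀ p ∈ S₁, D.DeltaDefined ε p.1 p.2.1 p.2.2 :=
    fun ε hε p hp => hdef ε hε _ hp.1 _ hp.2.1 _ hp.2.2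
  have hGcont : ContinuousOn (fun p : X × X × X => G p.1 p.2.1 p.2.2) S₁ := by
    refine hunif.continuousOn (Eventually.frequently ?_)
    filter_upwards [Ioo_mem_nhdsGT hε₁.1] with ε hε
    exact hD.continuousOn_delta ⟨hε.1, hε.2.trans hε₁.2⟩ (hdefS₁ ε hε)
  have hGfix : ∀ x ∈ K, G x x x = x := by
    intro x hx
    have hmem : (x, x, x) ∈ S₁ :=
      ⟨hKK₁ hx, mem_closedBall_self hR₁.le, mem_closedBall_self hR₁.le⟩
    refine tendsto_nhds_unique (hunif.tendsto_at hmem) (tendsto_const_nhds.congr' ?_)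
    filter_upwards [self_mem_nhdsWithin] with ε hε
    have hε' : 0 < ε := hε
    rw [Delta, hD.a1.fix _ _ hε', hD.a1.fix _ _ (inv_pos.2 hε')]
  -- For `u` close to `x`, the inverse `G x u x` is close to `x`, so that `G x (G x u x) v` is
  -- within the range of uniform convergence.
  obtain ⟨r, hr, hGr⟩ := Metric.uniformContinuousOn_iff.1
    ((isCompact_near hK₁ R₁).uniformContinuousOn_of_continuous hGcont) R₁ hR₁
  obtain ⟨R, hR, hRR₁, hRr, hR1⟩ : ∃ R > 0, R < R₁ ∧ R < r ∧ R ≤ 1 := by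
    refine ⟨min (min R₁ r / 2) 1, by positivity, ?_, ?_, min_le_right _ _⟩
    · exact (min_le_left _ _).trans_lt
        ((half_lt_self (lt_min hR₁ hr)).trans_le (min_le_left _ _))
    · exact (min_le_left _ _).trans_lt
        ((half_lt_self (lt_min hR₁ hr)).trans_le (min_le_right _ _))
  set S : Set (X × X × X) := {p | p.1 ∈ K ∧ p.2.1 ∈ closedBall p.1 R ∧
    p.2.2 ∈ closedBall p.1 R} with hS
  have hScomp : IsCompact S := isCompact_near hK R
  have hmem₁ : ∀ p ∈ S, (p.1, p.2.1, p.1) ∈ S₁ := fun p hp =>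
    ⟨hKK₁ hp.1, closedBall_subset_closedBall hRR₁.le hp.2.1, mem_closedBall_self hR₁.le⟩
  have hinv : ∀ p ∈ S, dist (G p.1 p.2.1 p.1) p.1 < R₁ := by
    intro p hp
    have h := hGr _ (hmem₁ p hp) (p.1, p.1, p.1)
      ⟨hKK₁ hp.1, mem_closedBall_self hR₁.le, mem_closedBall_self hR₁.le⟩ (by
        have h1 : dist p.2.1 p.1 ≤ R := hp.2.1
        simp only [Prod.dist_eq, dist_self]
        exact max_lt hr (max_lt (h1.trans_lt hRr) hr))
    simpa only [hGfix p.1 hp.1] using h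
  have hmem₂ : ∀ p ∈ S, (p.1, G p.1 p.2.1 p.1, p.2.2) ∈ S₁ := fun p hp =>
    ⟨hKK₁ hp.1, (hinv p hp).le, closedBall_subset_closedBall hRR₁.le hp.2.2⟩
  have hlimit : ∀ (l : Filter (ℝ × (X × X × X))) (q : ℝ × (X × X × X) → X × X × X)
      (p₀ : X × X × X), Tendsto Prod.fst l (𝓝[>] 0) → Tendsto q l (𝓝 p₀) →
      (∀ᶠ y in l, q y ∈ S₁) → p₀ ∈ S₁ →
      Tendsto (fun y => D.Delta y.1 (q y).1 (q y).2.1 (q y).2.2) l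
        (𝓝 (G p₀.1 p₀.2.1 p₀.2.2)) := by
    intro l q p₀ hl hq hqS hp₀
    have h1 := tendstoLocallyUniformlyOn_iff_forall_tendsto.1 hunif.tendstoLocallyUniformlyOn p₀ hp₀
    have hq' : Tendsto q l (𝓝[S₁] p₀) := tendsto_nhdsWithin_iff.2 ⟨hq, hqS⟩
    have h2 := h1.comp (hl.prodMk hq')
    exact ((hGcont p₀ hp₀).tendsto.comp hq').congr_uniformity h2
  have key : ∀ p₀ ∈ S,
      (∀ᶠ y : ℝ × (X × X × X) in 𝓝[>] 0 ×ˢ 𝓝[S] p₀,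
        D.SigmaDefined y.1 y.2.1 y.2.2.1 y.2.2.2) ∧
      Tendsto (fun y : ℝ × (X × X × X) => D.Sigma y.1 y.2.1 y.2.2.1 y.2.2.2)
        (𝓝[>] 0 ×ˢ 𝓝[S] p₀) (𝓝 (G p₀.1 (G p₀.1 p₀.2.1 p₀.1) p₀.2.2)) := by
    intro p₀ hp₀
    set l : Filter (ℝ × (X × X × X)) := 𝓝[>] 0 ×ˢ 𝓝[S] p₀ with hl
    have hl1 : Tendsto Prod.fst l (𝓝[>] 0) := tendsto_fst
    have hl2 : Tendsto Prod.snd l (𝓝[S] p₀) := tendsto_snd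
    have hpS : ∀ᶠ y in l, y.2 ∈ S := hl2 self_mem_nhdsWithin
    have hp : Tendsto Prod.snd l (𝓝 p₀) := hl2.mono_right nhdsWithin_le_nhds
    have hpx : Tendsto (fun y => y.2.1) l (𝓝 p₀.1) := hp.fst_nhds
    have hpu : Tendsto (fun y => y.2.2.1) l (𝓝 p₀.2.1) := hp.snd_nhds.fst_nhds
    have hpv : Tendsto (fun y => y.2.2.2) l (𝓝 p₀.2.2) := hp.snd_nhds.snd_nhds
    have hU : ∀ p ∈ S, p.2.1 ∈ D.U p.1 := fun p hp =>
      hD.a0.closedBall_subset p.1 (closedBall_subset_closedBall (hR1.trans hD.a0.one_lt.le) hp.2.1)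
    have hx' : Tendsto (fun y => D.δ y.1 y.2.1 y.2.2.1) l (𝓝 p₀.1) :=
      hD.a1.tendsto_δ_zero hl1 hpx hpu (hpS.mono fun y hy => hU _ hy) (hU _ hp₀)
    have hw : Tendsto (fun y => D.Delta y.1 y.2.1 y.2.2.1 y.2.1) l (𝓝 (G p₀.1 p₀.2.1 p₀.1)) :=
      hlimit l (fun y => (y.2.1, y.2.2.1, y.2.1)) (p₀.1, p₀.2.1, p₀.1) hl1
        (hpx.prodMk_nhds (hpu.prodMk_nhds hpx)) (hpS.mono fun y hy => hmem₁ _ hy) (hmem₁ _ hp₀)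
    have hmem : ∀ᶠ y in l, (D.δ y.1 y.2.1 y.2.2.1, D.Delta y.1 y.2.1 y.2.2.1 y.2.1, y.2.2.2) ∈
        S₁ := by
      have hv₀ : dist p₀.2.2 p₀.1 < R₁ := lt_of_le_of_lt hp₀.2.2 hRR₁
      filter_upwards [hx' (closedBall_mem_nhds _ one_pos),
        (hw.dist hx').eventually_lt_const (hinv _ hp₀),
        (hpv.dist hx').eventually_lt_const hv₀] with y h1 h2 h3
      exact ⟨mem_cthickening_of_dist_le _ _ _ _ hp₀.1 h1, h2.le, h3.le⟩
    have hsig : ∀ᶠ y in l, D.SigmaDefined y.1 y.2.1 y.2.2.1 y.2.2.2 ∧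
        D.Sigma y.1 y.2.1 y.2.2.1 y.2.2.2 = D.Delta y.1 (D.δ y.1 y.2.1 y.2.2.1)
          (D.Delta y.1 y.2.1 y.2.2.1 y.2.1) y.2.2.2 := by
      filter_upwards [hmem, hpS, hl1 (Ioo_mem_nhdsGT hε₁.1),
        (hpx.dist hx').eventually_lt_const (show dist p₀.1 p₀.1 < A by
          rw [dist_self]; exact hD.A_pos)] with y h1 h2 h3 h4
      exact hD.sigma_eq_delta ⟨h3.1, h3.2.trans hε₁.2⟩ (hdefS₁ _ h3 _ (hmem₁ _ h2))
        (hD.a0.closedBall_subset _ h4.le) (hdefS₁ _ h3 _ h1)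
    refine ⟨hsig.mono fun y hy => hy.1, ?_⟩
    exact (hlimit l (fun y => (D.δ y.1 y.2.1 y.2.2.1, D.Delta y.1 y.2.1 y.2.2.1 y.2.1, y.2.2.2))
      (p₀.1, G p₀.1 p₀.2.1 p₀.1, p₀.2.2) hl1 (hx'.prodMk_nhds (hw.prodMk_nhds hpv)) hmem
      (hmem₂ _ hp₀)).congr' (hsig.mono fun y hy => hy.2.symm)
  refine ⟨R, hR, ?_, ?_⟩
  · have h : ∀ᶠ ε in 𝓝[>] (0 : ℝ), ∀ p ∈ S, D.SigmaDefined ε p.1 p.2.1 p.2.2 := by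
      rw [eventually_nhdsWithin_iff]
      have := hScomp.eventually_forall_of_forall_eventually (x₀ := (0 : ℝ))
        (P := fun ε p => ε ∈ Ioi 0 → p ∈ S → D.SigmaDefined ε p.1 p.2.1 p.2.2) fun p₀ hp₀ => by
          have h1 := (key p₀ hp₀).1
          rw [← nhdsWithin_prod_eq, eventually_nhdsWithin_iff] at h1
          exact h1.mono fun y hy h2 h3 => hy ⟨h2, h3⟩
      exact this.mono fun ε hε h0 p hp => hε p hp h0 hp
    obtain ⟨ε₂, hε₂, hε₂'⟩ := mem_nhdsGT_iff_exists_Ioo_subset.1 h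
    refine ⟨min ε₂ (1 / 2), ⟨lt_min hε₂ (by norm_num), ?_⟩, fun ε hε x hx u hu v hv => ?_⟩
    · exact (min_le_right _ _).trans_lt (by norm_num)
    · exact hε₂' ⟨hε.1, hε.2.trans_le (min_le_left _ _)⟩ (x, u, v) ⟨hx, hu, hv⟩
  · refine (tendstoLocallyUniformlyOn_iff_tendstoUniformlyOn_of_compact hScomp).1 ?_
    rw [tendstoLocallyUniformlyOn_iff_forall_tendsto]
    intro p₀ hp₀
    have hcont : ContinuousOn (fun p : X × X × X => G p.1 (G p.1 p.2.1 p.1) p.2.2) S := by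
      have h1 : ContinuousOn (fun p : X × X × X => G p.1 p.2.1 p.1) S :=
        hGcont.comp (f := fun p : X × X × X => (p.1, p.2.1, p.1)) (by fun_prop) hmem₁
      exact hGcont.comp (f := fun p : X × X × X => (p.1, G p.1 p.2.1 p.1, p.2.2))
        (continuousOn_fst.prodMk (h1.prodMk (by fun_prop))) hmem₂
    have h2 := ((hcont p₀ hp₀).tendsto.comp
      (tendsto_snd (f := 𝓝[>] (0 : ℝ)) (g := 𝓝[S] p₀))).prodMk_nhds (key p₀ hp₀).2
    exact h2.mono_right (nhds_prod_eq.trans_le (nhds_prod_eq.symm.trans_le (nhds_le_uniformity _)))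

end DilationField

/-! ### Length dilatation structures -/

theorem corollary44 {X : Type*} [MetricSpace X] (D : DilationField X) (A B : ℝ)
    (d : X → X → X → ℝ) (hD : D.IsStrongDilatationStructure A B d) (htemp : D.IsTempered d)
    (hRN : D.HasRadonNikodym) : D.IsLengthDilatationStructure := by
  have hX : IsLengthMetric X := htemp.1
  have : ProperSpace X := hX.properSpace hD.compact_closedBall
  obtain ⟨G, hG⟩ := hD.a4
  exact
    { complete := hD.complete
      locallyCompact := inferInstance
      a0 := ⟨A, B, hD.a0⟩
      a1 := hD.a1
      a2 := hD.a2
      a3L := ⟨D.limitLength, fun ε hε hε0 =>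
        ⟨fun z₀ hz₀ z hz hzz => hD.limitLength_le_liminf hz₀.1 hε hε0 hz hzz,
          fun z₀ hz₀ => hD.exists_recovery hX hz₀.1 hε hε0⟩⟩
      a4Plus := ⟨⟨G, hG⟩, _, hD.convergesNear_sigma hG⟩ }
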